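/- Consider binary branching Brownian motion (BBM) on $\mathbb R$: one particle starts at $0$ and moves as a standard Brownian motion; each particle splits into two after an independent standard exponential lifetime, and the two offspring continue from the place of the split as independent copies, independently of each other and of the past. Let $n(t)$ be the number of particles at time $t\ge 0$ and $x_1(t),\dots,x_{n(t)}(t)$ their positions. For $\sigma\in(0,1]$, define the tilted probability of an event $A$ at time $t$ by $$\widehat P_{\sigma,t}(A)=\frac{\mathbb E\big[\sigma^{n(t)-1}\mathbf 1_A\big]}{\mathbb E\big[\sigma^{n(t)-1}\big]},$$ and let $$w_\sigma(t,x)=1-\widehat P_{\sigma,t}\big(x_i(t)\le x\text{ for all } 1\le i\le n(t)\big)$$ be the tilted probability that some particle exceeds $x$ at time $t$. Then $w_\sigma$ is the unique solution on $[0,\infty)\times\mathbb R$ of the time-inhomogeneous F-KPP equation $$\partial_t w=\tfrac12\,\partial_{xx}w+w(1-w)\,\frac{\sigma}{(1-\sigma)e^{t}+\sigma},\qquad t>0,\ x\in\mathbb R,$$ with Heaviside initial condition $w(0,x)=\mathbf 1_{x<0}$. Here a solution is a function $w:[0,\infty)\times\mathbb R\to\mathbb R$, bounded on $[0,T]\times\mathbb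 R$ for every $T<\infty$, with $w(0,x)=\mathbf 1_{x<0}$ for all $x$, which is continuous at $(0,x)$ for every $x\neq0$, has continuous derivatives $\partial_tw,\partial_xw,\partial_{xx}w$ on $(0,\infty)\times\mathbb R$, and satisfies the equation there. -/

import Mathlib

open MeasureTheory ProbabilityTheory
open scoped NNReal

noncomputable section

namespace BBM

/-- The primitive data of binary branching Brownian motion, with particles labelled by finite binary
words (`[]` is the initial particle, `b :: u` with `b : Bool` are the two children of `u`):
`e u` is the lifetime of particle `u` and `B u` is its displacement since its birth.
The lifetimes are standard exponential, the displacements are standard Brownian motions, and all of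
them are mutually independent. -/
structure IsBBM {Ω : Type*} [MeasurableSpace Ω] (e : List Bool → Ω → ℝ)
    (B : List Bool → ℝ≥0 → Ω → ℝ) (P : Measure Ω) : Prop where
  measurable_lifetime : ∀ u, Measurable (e u)
  measurable_displacement : ∀ u s, Measurable (B u s)
  lifetime_law : ∀ u, HasLaw (e u) (expMeasure 1) P
  brownian : ∀ u, IsBrownianReal (B u) P
  indep_lifetime_displacement : ∀ u, IndepFun (e u) (fun ω (s : ℝ≥0) => B u s ω) P
  indep_particles : iIndepFun (fun u ω => (e u ω, fun s : ℝ≥0 => B u s ω)) P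

variable {Ω : Type*}

/-- Birth time of particle `u`. -/
def birthTime (e : List Bool → Ω → ℝ) : List Bool → Ω → ℝ
  | [], _ => 0
  | _ :: u, ω => birthTime e u ω + e u ω

/-- Birth place of particle `u`. -/
def birthPlace (e : List Bool → Ω → ℝ) (B : List Bool → ℝ≥0 → Ω → ℝ) : List Bool → Ω → ℝ
  | [], _ => 0
  | _ :: u, ω => birthPlace e B u ω + B u (e u ω).toNNReal ω

/-- The set of particles alive at time `t`. -/
def alive (e : List Bool → Ω → ℝ) (t : ℝ) (ω : Ω) : Set (List Bool) :=
  {u | birthTime e u ω ≤ t ∧ t < birthTime e u ω + e u ω}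

/-- The number `n(t)` of particles at time `t` (almost surely finite and at least one). -/
def particleNumber (e : List Bool → Ω → ℝ) (t : ℝ) (ω : Ω) : ℕ :=
  (alive e t ω).ncard

/-- The position at time `t` of a particle `u` that is alive at time `t`. -/
def position (e : List Bool → Ω → ℝ) (B : List Bool → ℝ≥0 → Ω → ℝ) (u : List Bool) (t : ℝ)
    (ω : Ω) : ℝ :=
  birthPlace e B u ω + B u (t - birthTime e u ω).toNNReal ω

variable [MeasurableSpace Ω]

/-- The partition function `v_σ(t) = E[σ ^ (n(t) - 1)]`. -/
def partitionFunction (P : Measure Ω) (e : List Bool → Ω → ℝ) (σ t : ℝ) : ℝ :=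
  ∫ ω, σ ^ (particleNumber e t ω - 1) ∂P

/-- The tilted probability `E[σ ^ (n(t) - 1) 1_A] / E[σ ^ (n(t) - 1)]` of the event `A`. -/
def tiltedProb (P : Measure Ω) (e : List Bool → Ω → ℝ) (σ t : ℝ) (A : Set Ω) : ℝ :=
  (∫ ω, A.indicator (fun ω => σ ^ (particleNumber e t ω - 1)) ω ∂P) / partitionFunction P e σ t

/-- `w_σ(t, x)`: one minus the tilted probability that no particle exceeds `x` at time `t`. -/
def frontTail (P : Measure Ω) (e : List Bool → Ω → ℝ) (B : List Bool → ℝ≥0 → Ω → ℝ)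
    (σ t x : ℝ) : ℝ :=
  1 - tiltedProb P e σ t {ω | ∀ u ∈ alive e t ω, position e B u t ω ≤ x}

end BBM

/-- Bounded (locally uniformly in time) classical solutions `w : [0, ∞) × ℝ → ℝ` of
`∂ₜ w = ½ ∂ₓₓ w + g(t) w (1 - w)` with initial datum `w₀`: `w` is of class `C^{1,2}` for `t > 0`,
satisfies the equation there, equals `w₀` at `t = 0`, and is jointly continuous at `(0, x)`
for every continuity point `x` of `w₀`. The values for `t < 0` are irrelevant. -/
structure IsFKPPSolution (g : ℝ → ℝ) (w₀ : ℝ → ℝ) (w : ℝ → ℝ → ℝ) : Prop where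
  bounded : ∀ T : ℝ, ∃ C : ℝ, ∀ t, 0 ≤ t → t ≤ T → ∀ x, |w t x| ≤ C
  initial : ∀ x, w 0 x = w₀ x
  continuous_initial : ∀ x, ContinuousAt w₀ x →
    ContinuousWithinAt (fun p : ℝ × ℝ => w p.1 p.2) {p | 0 ≤ p.1} (0, x)
  differentiable_time : ∀ t, 0 < t → ∀ x, DifferentiableAt ℝ (fun s => w s x) t
  contDiff_space : ∀ t, 0 < t → ContDiff ℝ 2 (w t)
  continuous_deriv_time :
    ContinuousOn (fun p : ℝ × ℝ => deriv (fun s => w s p.2) p.1) {p | 0 < p.1}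
  continuous_deriv_space :
    ContinuousOn (fun p : ℝ × ℝ => deriv (w p.1) p.2) {p | 0 < p.1}
  continuous_deriv_space_two :
    ContinuousOn (fun p : ℝ × ℝ => iteratedDeriv 2 (w p.1) p.2) {p | 0 < p.1}
  equation : ∀ t, 0 < t → ∀ x,
    deriv (fun s => w s x) t
      = 1 / 2 * iteratedDeriv 2 (w t) x + w t x * (1 - w t x) * g t

/-- The reaction rate `σ / ((1 - σ) e^t + σ)`. -/
def reactionRate (σ t : ℝ) : ℝ := σ / ((1 - σ) * Real.exp t + σ)

/-- The Heaviside datum `1_{x < 0}`. -/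
def heavisideDatum (x : ℝ) : ℝ := if x < 0 then 1 else 0

end

/-! Put `v(t) = E[σ^n(t)]` and `u(t,x) = E[σ^n(t); all particles ≤ x]`. Multiplying numerator and
denominator of the tilted probability by `σ` gives `w = 1 - u / v`. At the first split the tree
falls into two independent copies of itself, and `σ^n` is multiplicative over them. Conditioning on
the lifetime and path of the first particle therefore gives for both `u` and `v` the Duhamel form of
`∂ₜu = ½ ∂ₓₓu + u² - u`, with initial data `σ 1_{x ≥ 0}` and `σ` (`isMildSolution_branchMean`).
Since `v` is constant in space, it solves `v' = v² - v`, whence `v = reactionRate σ`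
(`branchMean_univ`). In the equation for `1 - u / v` the linear terms cancel and `v w (1 - w)`
remains (`IsMildSolution.isFKPPSolution`): the prefactor of the F-KPP equation is the generating
function of `n(t)` itself.

Regularity needs an argument because the datum jumps. A mild solution may be restarted at any time
`s < t`. Averaging over restart times in an interval writes it as a space-time convolution of an
integrable kernel with a bounded source (`eq_conv_heatKer`). The kernel has one integrable space
derivative. This gives one derivative of `u`; a later restart, whose source is now differentiable,
gives a second one. The time derivative comes from restarting at `t` and letting the increment
shrink.

Uniqueness is a maximum principle for the difference of two solutions (`sub_le_barrier`,
`IsFKPPSolution.le`). The only obstruction is the jump at the origin. It is hidden under a Gaussian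
barrier whose height at the origin beats the difference but which vanishes at each later time as its
width parameter tends to zero. -/

open Set Filter Topology

/-! ### Space-time convolution of an integrable kernel with a bounded function -/

namespace BBM

/-- Convolution of two functions on `ℝ × ℝ`. -/
noncomputable def conv (k q : ℝ × ℝ → ℝ) (p : ℝ × ℝ) : ℝ := ∫ z, k z * q (p - z)

lemma integrable_mul_of_bounded {α : Type*} [MeasurableSpace α] {μ : Measure α} {k q : α → ℝ}
    (hk : Integrable k μ) (hq : Measurable q) {C : ℝ} (hb : ∀ p, |q p| ≤ C) :
    Integrable (fun z => k z * q z) μ := by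
  refine hk.mul_bdd (c := C) hq.aestronglyMeasurable (ae_of_all _ fun z => ?_)
  simpa using hb z

lemma abs_integral_mul_le_of_bounded {α : Type*} [MeasurableSpace α] {μ : Measure α} {k q : α → ℝ}
    (hk : Integrable k μ) {C : ℝ} (hb : ∀ p, |q p| ≤ C) :
    |∫ z, k z * q z ∂μ| ≤ (∫ z, |k z| ∂μ) * C := by
  rw [← integral_mul_const]
  refine (abs_integral_le_integral_abs).trans (integral_mono_of_nonneg ?_ ?_ ?_)
  · exact ae_of_all _ fun z => abs_nonneg _
  · exact hk.abs.mul_const C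
  · refine ae_of_all _ fun z => ?_
    simp only [abs_mul]
    exact mul_le_mul_of_nonneg_left (hb z) (abs_nonneg _)

lemma abs_conv_le {k q : ℝ × ℝ → ℝ} (hk : Integrable k) {C : ℝ} (hb : ∀ p, |q p| ≤ C)
    (p : ℝ × ℝ) : |conv k q p| ≤ (∫ z, |k z|) * C :=
  abs_integral_mul_le_of_bounded hk fun z => hb (p - z)

/-- Continuous compactly supported kernels approximate `k` in L¹, and boundedness of `q` makes the
resulting approximation of the convolution uniform. No regularity of `q` is used. -/
lemma continuous_conv {k q : ℝ × ℝ → ℝ} (hk : Integrable k) (hq : Measurable q) {C : ℝ}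
    (hb : ∀ p, |q p| ≤ C) : Continuous (conv k q) := by
  have hC : 0 ≤ C := (abs_nonneg _).trans (hb 0)
  refine continuous_of_uniform_approx_of_continuous fun u hu => ?_
  obtain ⟨ε, hε, hεu⟩ := Metric.mem_uniformity_dist.1 hu
  obtain ⟨g, hgs, hgk, hgc, hgi⟩ :=
    hk.exists_hasCompactSupport_integral_sub_le (ε := ε / (2 * (C + 1))) (by positivity)
  refine ⟨conv g q, ?_, fun p => hεu ?_⟩
  · have hloc : LocallyIntegrable q := by
      refine (locallyIntegrable_const C).mono hq.aestronglyMeasurable (ae_of_all _ fun z => ?_)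
      simpa using (hb z).trans (le_abs_self C)
    exact hgs.continuous_convolution_left (ContinuousLinearMap.mul ℝ ℝ) hgc hloc
  · rw [Real.dist_eq, conv, conv, ← integral_sub]
    · simp_rw [← sub_mul]
      refine (abs_integral_mul_le_of_bounded (hk.sub hgi) fun z => hb (p - z)).trans_lt ?_
      have h1 : (∫ z, |k z - g z|) ≤ ε / (2 * (C + 1)) := by simpa using hgk
      calc _ ≤ ε / (2 * (C + 1)) * C := mul_le_mul_of_nonneg_right h1 hC
        _ < ε := by
          rw [div_mul_eq_mul_div, div_lt_iff₀ (by positivity)]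
          nlinarith
    · exact integrable_mul_of_bounded hk (by fun_prop) fun z => hb (p - z)
    · exact integrable_mul_of_bounded hgi (by fun_prop) fun z => hb (p - z)

/-- Differentiation of a convolution in space, the derivative falling on the kernel. -/
lemma hasDerivAt_conv_left {k k' q : ℝ × ℝ → ℝ} (hk : Integrable k) (hk' : Integrable k')
    (hm' : Measurable k') (hq : Measurable q) {C : ℝ} (hb : ∀ p, |q p| ≤ C)
    (hd : ∀ r z, HasDerivAt (fun z => k (r, z)) (k' (r, z)) z)
    (hc : ∀ r, Continuous fun z => k' (r, z)) (t x : ℝ) :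
    HasDerivAt (fun x => conv k q (t, x)) (conv k' q (t, x)) x := by
  have hcont : Continuous fun x => conv k' q (t, x) :=
    (continuous_conv hk' hq hb).comp (by fun_prop)
  have hmp : ∀ ξ : ℝ, MeasurePreserving (fun z : ℝ × ℝ => (z.1, ξ - z.2)) := fun ξ =>
    (MeasurePreserving.id (volume : Measure ℝ)).prod (Measure.measurePreserving_sub_left volume ξ)
  -- Only the space coordinate is reflected, so that the space variable occurs in the kernel alone;
  -- the other factor is merely measurable.
  have hflip : ∀ (f : ℝ × ℝ → ℝ) (ξ : ℝ),
      conv f q (t, ξ) = ∫ z : ℝ × ℝ, f (z.1, ξ - z.2) * q (t - z.1, z.2) := by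
    intro f ξ
    have hme : MeasurableEmbedding (fun z : ℝ × ℝ => (z.1, ξ - z.2)) :=
      ((MeasurableEquiv.refl ℝ).prodCongr (MeasurableEquiv.subLeft ξ)).measurableEmbedding
    have := (hmp ξ).integral_comp hme (fun z => f z * q ((t, ξ) - z))
    rw [conv, ← this]
    simp
  have hint : ∀ (f : ℝ × ℝ → ℝ) (_ : Integrable f) (ξ : ℝ),
      Integrable fun z : ℝ × ℝ => f (z.1, ξ - z.2) * q (t - z.1, z.2) := fun f hf ξ =>
    integrable_mul_of_bounded ((hmp ξ).integrable_comp_of_integrable hf) (by fun_prop)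
      fun z => hb (t - z.1, z.2)
  -- The translates of `k'` need not have a common integrable majorant, so one does not
  -- differentiate under the integral. Fubini exhibits the convolution as a primitive of `conv k'
  -- q`, which is continuous.
  have hFTC : ∀ b, conv k q (t, b) = conv k q (t, x) + ∫ ξ in x..b, conv k' q (t, ξ) := by
    intro b
    have hprod : Integrable (Function.uncurry fun (ξ : ℝ) (z : ℝ × ℝ) =>
        k' (z.1, ξ - z.2) * q (t - z.1, z.2)) ((volume.restrict (uIoc x b)).prod volume) := by
      refine (integrable_prod_iff (by
        refine Measurable.aestronglyMeasurable ?_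
        unfold Function.uncurry
        fun_prop)).2 ⟨ae_of_all _ fun ξ => hint k' hk' ξ, ?_⟩
      have hK : IntegrableOn (fun _ : ℝ => (∫ z, |k' z|) * C) (uIoc x b) volume :=
        integrableOn_const (by simp [uIoc])
      refine Integrable.mono' hK ?_ (ae_of_all _ fun ξ => ?_)
      · refine (Measurable.stronglyMeasurable ?_).integral_prod_right.aestronglyMeasurable
        unfold Function.uncurry
        fun_prop
      · rw [Real.norm_eq_abs, abs_of_nonneg (integral_nonneg fun _ => norm_nonneg _)]
        have h1 : ∫ z : ℝ × ℝ, |k' (z.1, ξ - z.2)| = ∫ z, |k' z| :=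
          (hmp ξ).integral_comp ((MeasurableEquiv.refl ℝ).prodCongr
            (MeasurableEquiv.subLeft ξ)).measurableEmbedding fun z => |k' z|
        rw [← h1, ← integral_mul_const]
        refine integral_mono (hint k' hk' ξ).norm
          (((hmp ξ).integrable_comp_of_integrable hk').abs.mul_const C) fun z => ?_
        simp only [Function.uncurry, norm_mul, Real.norm_eq_abs]
        exact mul_le_mul_of_nonneg_left (hb _) (abs_nonneg _)
    have hswap : ∫ ξ in x..b, conv k' q (t, ξ)
        = ∫ z : ℝ × ℝ, ∫ ξ in x..b, k' (z.1, ξ - z.2) * q (t - z.1, z.2) := by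
      simp_rw [hflip k']
      exact intervalIntegral_integral_swap hprod
    rw [hswap, hflip, hflip, ← sub_eq_iff_eq_add', ← integral_sub (hint k hk b) (hint k hk x)]
    refine integral_congr_ae (ae_of_all _ fun z => ?_)
    simp only [intervalIntegral.integral_mul_const, ← sub_mul]
    congr 1
    refine (intervalIntegral.integral_eq_sub_of_hasDerivAt
      (f := fun ξ => k (z.1, ξ - z.2)) (fun ξ _ => ?_) ?_).symm
    · exact (hd z.1 (ξ - z.2)).comp_sub_const ξ z.2
    · exact ((hc z.1).comp (continuous_id.sub continuous_const)).intervalIntegrable _ _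
  have := (intervalIntegral.integral_hasDerivAt_right (hcont.intervalIntegrable x x)
    hcont.stronglyMeasurable.stronglyMeasurableAtFilter hcont.continuousAt).const_add
      (conv k q (t, x))
  exact this.congr_of_eventuallyEq (Eventually.of_forall hFTC)

/-- Differentiation of a convolution in space, the derivative falling on the second factor. -/
lemma hasDerivAt_conv_right {k q q' : ℝ × ℝ → ℝ} (hk : Integrable k)
    (hq : Measurable q) {C : ℝ} (hb : ∀ p, |q p| ≤ C) (hq' : Measurable q')
    {C' : ℝ} (hb' : ∀ p, |q' p| ≤ C')
    (hd : ∀ r z, HasDerivAt (fun z => q (r, z)) (q' (r, z)) z) (t x : ℝ) :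
    HasDerivAt (fun x => conv k q (t, x)) (conv k q' (t, x)) x := by
  refine (hasDerivAt_integral_of_dominated_loc_of_deriv_le (F := fun x z => k z * q ((t, x) - z))
    (F' := fun x z => k z * q' ((t, x) - z)) (bound := fun z => |k z| * C') (s := univ)
    univ_mem ?_ ?_ ?_ ?_ ?_ ?_).2
  · exact Eventually.of_forall fun y =>
      (integrable_mul_of_bounded hk (by fun_prop) fun z => hb ((t, y) - z)).aestronglyMeasurable
  · exact integrable_mul_of_bounded hk (by fun_prop) fun z => hb ((t, x) - z)
  · exact (integrable_mul_of_bounded hk (by fun_prop)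
      fun z => hb' ((t, x) - z)).aestronglyMeasurable
  · refine ae_of_all _ fun z y _ => ?_
    rw [Real.norm_eq_abs, abs_mul]
    exact mul_le_mul_of_nonneg_left (hb' _) (abs_nonneg _)
  · exact hk.abs.mul_const C'
  · refine ae_of_all _ fun z y _ => ?_
    have := (hd (t - z.1) (y - z.2)).comp_sub_const y z.2
    exact this.const_mul (k z)

/-! ### The damped heat kernel and the heat semigroup -/

/-- The heat semigroup `E[f (x - B_t)]`. -/
noncomputable def heatOp (t : ℝ) (f : ℝ → ℝ) (x : ℝ) : ℝ := ∫ y, f (x - y) ∂(gaussianReal 0 t.toNNReal)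

/-- The heat kernel damped by `exp (-r)`, extended by zero to negative times. -/
noncomputable def heatKer (p : ℝ × ℝ) : ℝ :=
  if 0 < p.1 then Real.exp (-p.1) * gaussianPDFReal 0 p.1.toNNReal p.2 else 0

/-- The space derivative of `heatKer`. -/
noncomputable def heatKerDeriv (p : ℝ × ℝ) : ℝ := -(p.2 / p.1) * heatKer p

lemma measurable_heatKer : Measurable heatKer := by
  refine Measurable.ite (measurableSet_lt measurable_const measurable_fst) ?_ measurable_const
  refine (by fun_prop : Measurable fun p : ℝ × ℝ => Real.exp (-p.1)).mul ?_
  exact measurable_uncurry_gaussianPDFReal.comp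
    (measurable_const.prodMk ((measurable_real_toNNReal.comp measurable_fst).prodMk measurable_snd))

lemma measurable_heatKerDeriv : Measurable heatKerDeriv := by
  unfold heatKerDeriv
  exact (by fun_prop : Measurable fun p : ℝ × ℝ => -(p.2 / p.1)).mul measurable_heatKer

lemma heatKer_nonneg (p : ℝ × ℝ) : 0 ≤ heatKer p := by
  unfold heatKer
  split_ifs
  · exact mul_nonneg (Real.exp_nonneg _) (gaussianPDFReal_nonneg _ _ _)
  · exact le_rfl

lemma hasDerivAt_heatKer (r z : ℝ) :
    HasDerivAt (fun z => heatKer (r, z)) (heatKerDeriv (r, z)) z := by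
  by_cases hr : 0 < r
  · have hr' : (r.toNNReal : ℝ) = r := Real.coe_toNNReal r hr.le
    simp only [heatKerDeriv, heatKer, hr, if_true, gaussianPDFReal, hr', sub_zero]
    have h1 : HasDerivAt (fun z : ℝ => -z ^ 2 / (2 * r)) (-(2 * z) / (2 * r)) z := by
      simpa using ((hasDerivAt_pow 2 z).neg.div_const (2 * r))
    have h2 := (h1.exp.const_mul (√(2 * Real.pi * r))⁻¹).const_mul (Real.exp (-r))
    have h3 : -(2 * z) / (2 * r) = -(z / r) := by
      rw [neg_div, mul_div_mul_left z r two_ne_zero]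
    rw [h3] at h2
    refine h2.congr_deriv ?_
    ring
  · simp only [heatKerDeriv, heatKer, hr, if_false, mul_zero]
    exact hasDerivAt_const _ _

lemma continuous_heatKerDeriv (r : ℝ) : Continuous fun z => heatKerDeriv (r, z) := by
  have h : Continuous fun z => heatKer (r, z) :=
    continuous_iff_continuousAt.2 fun z => (hasDerivAt_heatKer r z).continuousAt
  exact (by fun_prop : Continuous fun z : ℝ => -(z / r)).mul h

lemma integral_mul_heatKer {r : ℝ} (hr : 0 < r) (f : ℝ → ℝ) :
    ∫ z, heatKer (r, z) * f z = Real.exp (-r) * ∫ z, f z ∂(gaussianReal 0 r.toNNReal) := by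
  rw [integral_gaussianReal_eq_integral_smul (by simpa using hr), ← integral_const_mul]
  simp [heatKer, hr, mul_assoc]

lemma integrable_heatKer_slice (r : ℝ) : Integrable fun z => heatKer (r, z) := by
  unfold heatKer
  by_cases hr : 0 < r
  · simpa [hr] using (integrable_gaussianPDFReal 0 r.toNNReal).const_mul (Real.exp (-r))
  · simp [hr]

lemma integrable_mul_gaussianPDFReal {v : ℝ≥0} (hv : v ≠ 0) {f : ℝ → ℝ}
    (hf : Integrable f (gaussianReal 0 v)) : Integrable fun z => gaussianPDFReal 0 v z * f z := by
  rw [gaussianReal_of_var_ne_zero 0 hv] at hf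
  have := (integrable_withDensity_iff_integrable_smul' (measurable_gaussianPDF 0 v)
    (ae_of_all _ fun x => gaussianPDF_lt_top)).1 hf
  simpa [toReal_gaussianPDF] using this

/-- The slice at time `r` has mass `exp (-r)`: the damping, which is the probability of no split
before `r`, makes the kernel integrable over all times. -/
lemma integrable_heatKer : Integrable heatKer := by
  refine (integrable_prod_iff measurable_heatKer.aestronglyMeasurable).2
    ⟨ae_of_all _ integrable_heatKer_slice, ?_⟩
  have h : (fun r : ℝ => ∫ z, ‖heatKer (r, z)‖) = (Ioi 0).indicator fun r => Real.exp (-r) := by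
    ext r
    by_cases hr : 0 < r
    · simp only [Real.norm_eq_abs, abs_of_nonneg (heatKer_nonneg _)]
      simpa [hr] using integral_mul_heatKer hr fun _ => 1
    · simp [heatKer, hr]
  rw [h]
  exact (integrableOn_exp_neg_Ioi 0).integrable_indicator measurableSet_Ioi

lemma integral_abs_gaussianReal_le {r : ℝ} (hr : 0 < r) :
    ∫ z, |z| ∂(gaussianReal 0 r.toNNReal) ≤ √r := by
  have hs : 0 < √r := Real.sqrt_pos.2 hr
  have hsq : Integrable (fun z : ℝ => z ^ 2) (gaussianReal 0 r.toNNReal) :=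
    (memLp_id_gaussianReal 2).integrable_sq
  have hvar : ∫ z, z ^ 2 ∂(gaussianReal 0 r.toNNReal) = r := by
    have := variance_fun_id_gaussianReal (μ := 0) (v := r.toNNReal)
    rw [variance_eq_integral (by fun_prop)] at this
    simpa [integral_id_gaussianReal, hr.le] using this
  -- Integrate `|z| ≤ √r / 2 + z² / (2 √r)`; this choice of weights makes both terms contribute `√r
  -- / 2`.
  calc ∫ z, |z| ∂(gaussianReal 0 r.toNNReal)
      ≤ ∫ z, (√r / 2 + z ^ 2 * (1 / (2 * √r))) ∂(gaussianReal 0 r.toNNReal) := by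
        refine integral_mono_of_nonneg (ae_of_all _ fun z => abs_nonneg z)
          ((integrable_const _).add (hsq.mul_const _)) (ae_of_all _ fun z => ?_)
        have h2 : 0 ≤ (|z| - √r) ^ 2 / (2 * √r) := by positivity
        have h3 : (|z| - √r) ^ 2 / (2 * √r) = √r / 2 + z ^ 2 * (1 / (2 * √r)) - |z| := by
          field_simp
          rw [sub_sq, sq_abs]
          ring
        simp only
        linarith
    _ = √r := by
        rw [integral_add (integrable_const _) (hsq.mul_const _), integral_mul_const, hvar]
        simp
        have : r = √r * √r := (Real.mul_self_sqrt hr.le).symm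
        nth_rewrite 2 [this]
        field_simp
        ring

/-- The slice at time `r` has L¹ norm at most `exp (-r) r^(-1/2)`, the integrand of `Γ(1/2)`. A
second space derivative would cost `1 / r`, which is not integrable at zero; this is why second
derivatives of `u` are obtained in two stages. -/
lemma integrable_heatKerDeriv : Integrable heatKerDeriv := by
  have hslice : ∀ r, 0 < r → Integrable fun z => heatKerDeriv (r, z) := by
    intro r hr
    have h1 : Integrable (fun z : ℝ => z) (gaussianReal 0 r.toNNReal) :=
      (memLp_id_gaussianReal 1).integrable le_rfl
    have h2 := (integrable_mul_gaussianPDFReal (by simpa using hr) h1).const_mul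
      (-(1 / r) * Real.exp (-r))
    refine h2.congr (ae_of_all _ fun z => ?_)
    simp only [heatKerDeriv, heatKer, hr, if_true]
    ring
  refine (integrable_prod_iff measurable_heatKerDeriv.aestronglyMeasurable).2
    ⟨ae_of_all _ fun r => ?_, ?_⟩
  · by_cases hr : 0 < r
    · exact hslice r hr
    · simp [heatKerDeriv, heatKer, hr]
  · have hG : Integrable ((Ioi (0 : ℝ)).indicator fun r => Real.exp (-r) * r ^ ((1 / 2 : ℝ) - 1)) :=
      (Real.GammaIntegral_convergent (by norm_num)).integrable_indicator measurableSet_Ioi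
    refine hG.mono' ?_ (ae_of_all _ fun r => ?_)
    · exact (measurable_heatKerDeriv.norm.stronglyMeasurable.integral_prod_right').aestronglyMeasurable
    · rw [Real.norm_eq_abs, abs_of_nonneg (integral_nonneg fun _ => norm_nonneg _)]
      by_cases hr : 0 < r
      · have h1 : ∀ z, ‖heatKerDeriv (r, z)‖ = heatKer (r, z) * (|z| / r) := by
          intro z
          rw [heatKerDeriv, norm_mul, Real.norm_eq_abs, Real.norm_eq_abs,
            abs_of_nonneg (heatKer_nonneg _), abs_neg, abs_div, abs_of_pos hr, mul_comm]
        simp_rw [h1]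
        rw [integral_mul_heatKer hr, integral_div, indicator_of_mem (show r ∈ Ioi 0 from hr)]
        refine mul_le_mul_of_nonneg_left ?_ (Real.exp_nonneg _)
        rw [div_le_iff₀ hr, ← Real.rpow_add_one hr.ne']
        refine (integral_abs_gaussianReal_le hr).trans_eq ?_
        rw [Real.sqrt_eq_rpow]
        norm_num
      · simp [heatKerDeriv, heatKer, hr]

lemma abs_heatOp_le {t C x : ℝ} {f : ℝ → ℝ} (hb : ∀ y, |f y| ≤ C) : |heatOp t f x| ≤ C := by
  have := norm_integral_le_of_norm_le_const (μ := gaussianReal 0 t.toNNReal)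
    (f := fun y => f (x - y)) (C := C) (ae_of_all _ fun y => by simpa using hb (x - y))
  simpa [heatOp] using this

lemma heatOp_zero (f : ℝ → ℝ) (x : ℝ) : heatOp 0 f x = f x := by
  simp [heatOp, gaussianReal_zero_var]

lemma integrable_comp_gaussianReal {f : ℝ → ℝ} (hf : Measurable f) {C : ℝ} (hb : ∀ y, |f y| ≤ C)
    (v : ℝ≥0) (x : ℝ) : Integrable (fun y => f (x - y)) (gaussianReal 0 v) :=
  Integrable.of_bound (Measurable.aestronglyMeasurable (by fun_prop)) C (ae_of_all _ fun y => by simpa using hb (x - y))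

/-- The semigroup property. -/
lemma heatOp_heatOp {s t : ℝ} (hs : 0 ≤ s) (ht : 0 ≤ t) {f : ℝ → ℝ} (hf : Measurable f) {C : ℝ}
    (hb : ∀ y, |f y| ≤ C) (x : ℝ) : heatOp s (heatOp t f) x = heatOp (s + t) f x := by
  have h := gaussianReal_conv_gaussianReal (m₁ := 0) (m₂ := 0) (v₁ := s.toNNReal)
    (v₂ := t.toNNReal)
  rw [add_zero, ← Real.toNNReal_add hs ht] at h
  unfold heatOp
  rw [← h, Measure.conv, integral_map (by fun_prop) (Measurable.aestronglyMeasurable (by fun_prop)), integral_prod]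
  · simp only [sub_sub]
  · exact Integrable.of_bound (Measurable.aestronglyMeasurable (by fun_prop)) C (ae_of_all _ fun y => by simpa using hb _)

/-- Brownian scaling moves the time from the measure into the integrand, as measurability and
dominated convergence in `t` require. For `t ≤ 0` both sides are `f x`, since `√t = 0` and the
variance is zero. -/
lemma heatOp_eq_integral_std {f : ℝ → ℝ} (hf : Measurable f) (t x : ℝ) :
    heatOp t f x = ∫ z, f (x - √t * z) ∂(gaussianReal 0 1) := by
  have := gaussianReal_map_const_mul (μ := 0) (v := 1) (√t)
  rw [mul_zero, mul_one] at this
  have h2 : (NNReal.mk (√t ^ 2) (sq_nonneg _)) = t.toNNReal := by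
    ext
    rw [NNReal.coe_mk, Real.coe_toNNReal']
    rcases le_total 0 t with h | h
    · rw [Real.sq_sqrt h, max_eq_left h]
    · rw [Real.sqrt_eq_zero_of_nonpos h, max_eq_right h, zero_pow two_ne_zero]
  rw [h2] at this
  rw [heatOp, ← this, integral_map (by fun_prop)]
  exact Measurable.aestronglyMeasurable (by fun_prop)

/-- Joint measurability of the heat semigroup acting on a family of functions. -/
lemma measurable_heatOp {α : Type*} [MeasurableSpace α] {t x : α → ℝ} {f : α → ℝ → ℝ}
    (ht : Measurable t) (hx : Measurable x) (hf : Measurable (Function.uncurry f)) :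
    Measurable fun a => heatOp (t a) (f a) (x a) := by
  have h : ∀ a, heatOp (t a) (f a) (x a)
      = ∫ z, f a (x a - √(t a) * z) ∂(gaussianReal 0 1) := fun a =>
    heatOp_eq_integral_std (hf.comp measurable_prodMk_left) _ _
  simp_rw [h]
  refine (Measurable.stronglyMeasurable ?_).integral_prod_right.measurable
  unfold Function.uncurry
  exact hf.comp (by fun_prop : Measurable fun p : α × ℝ => (p.1, x p.1 - √(t p.1) * p.2))

lemma conv_heatKer {q : ℝ × ℝ → ℝ} (hq : Measurable q) {C : ℝ} (hb : ∀ p, |q p| ≤ C) (t x : ℝ) :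
    conv heatKer q (t, x)
      = ∫ r in Ioi 0, Real.exp (-r) * heatOp r (fun y => q (t - r, y)) x := by
  rw [conv, Measure.volume_eq_prod, integral_prod, ← integral_indicator measurableSet_Ioi]
  · refine integral_congr_ae (ae_of_all _ fun r => ?_)
    by_cases hr : 0 < r
    · simpa [hr, heatOp] using integral_mul_heatKer hr fun z => q (t - r, x - z)
    · simp [heatKer, hr]
  · exact integrable_mul_of_bounded integrable_heatKer (by fun_prop) fun z => hb ((t, x) - z)

end BBM

/-! ### Maximum principle and uniqueness -/

/-- Were the second derivative positive, the point would also be a local minimum, so `f` would be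
locally constant and its second derivative zero. -/
lemma deriv_deriv_nonpos_of_isLocalMax {f : ℝ → ℝ} {a : ℝ} (h : IsLocalMax f a)
    (hc : ContinuousAt f a) : deriv (deriv f) a ≤ 0 := by
  by_contra! hpos
  have hmin := isLocalMin_of_deriv_deriv_pos hpos h.deriv_eq_zero hc
  have heq : f =ᶠ[𝓝 a] fun _ => f a := by
    filter_upwards [h, hmin] with x h1 h2 using le_antisymm h1 h2
  rw [heq.deriv.deriv_eq] at hpos
  simp at hpos

/-- Only earlier times are compared, because the maximum may be attained at the final time. -/
lemma HasDerivAt.nonneg_of_le_left {f : ℝ → ℝ} {f' a c : ℝ} (h : HasDerivAt f f' a) (hc : c < a)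
    (hle : ∀ s ∈ Ioo c a, f s ≤ f a) : 0 ≤ f' := by
  have h1 : Tendsto (slope f a) (𝓝[<] a) (𝓝 f') :=
    (hasDerivAt_iff_tendsto_slope.1 h).mono_left (nhdsWithin_mono _ fun x hx => ne_of_lt hx)
  refine ge_of_tendsto h1 ?_
  filter_upwards [Ioo_mem_nhdsLT hc] with s hs
  rw [slope_def_field]
  exact div_nonneg_of_nonpos (sub_nonpos.2 (hle s hs)) (sub_nonpos.2 hs.2.le)

namespace IsFKPPSolution

/-- Joint continuity is not part of the definition at positive times. It follows from a local bound
on the space derivative, by the mean value inequality, and continuity in time along the fixed point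
`x`. -/
lemma continuousAt_uncurry {g w₀ : ℝ → ℝ} {w : ℝ → ℝ → ℝ} (h : IsFKPPSolution g w₀ w) {t : ℝ}
    (ht : 0 < t) (x : ℝ) : ContinuousAt (fun p : ℝ × ℝ => w p.1 p.2) (t, x) := by
  have hopen : IsOpen {p : ℝ × ℝ | 0 < p.1} := isOpen_lt continuous_const continuous_fst
  have hcx : ContinuousAt (fun p : ℝ × ℝ => deriv (w p.1) p.2) (t, x) :=
    h.continuous_deriv_space.continuousAt (hopen.mem_nhds ht)
  set L := |deriv (w t) x| + 1
  have hev : ∀ᶠ p : ℝ × ℝ in 𝓝 (t, x), 0 < p.1 ∧ |deriv (w p.1) p.2| < L :=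
    Eventually.and (show ∀ᶠ p : ℝ × ℝ in 𝓝 (t, x), 0 < p.1 from hopen.mem_nhds ht)
      (hcx.abs.eventually_lt_const (lt_add_one _))
  obtain ⟨ρ, hρ, hball⟩ := Metric.eventually_nhds_iff_ball.1 hev
  have h1 : Tendsto (fun p : ℝ × ℝ => w p.1 p.2 - w p.1 x) (𝓝 (t, x)) (𝓝 0) := by
    have hlim : Tendsto (fun p : ℝ × ℝ => L * ‖p.2 - x‖) (𝓝 (t, x)) (𝓝 0) := by
      have : Continuous fun p : ℝ × ℝ => L * ‖p.2 - x‖ := by fun_prop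
      simpa using this.tendsto (t, x)
    refine squeeze_zero_norm' ?_ hlim
    filter_upwards [Metric.ball_mem_nhds (t, x) hρ] with p hp
    rw [Metric.mem_ball, Prod.dist_eq, max_lt_iff] at hp
    have hpt : 0 < p.1 := (hball (p.1, x) (by simp [Prod.dist_eq, hp.1])).1
    refine (convex_ball x ρ).norm_image_sub_le_of_norm_deriv_le (f := w p.1) (C := L)
      (fun y _ => ((h.contDiff_space p.1 hpt).differentiable two_ne_zero) y) (fun y hy => ?_)
      (Metric.mem_ball_self hρ) hp.2
    exact (hball (p.1, y) (by simp only [Metric.mem_ball, Prod.dist_eq, max_lt_iff] at hy ⊢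
                              exact ⟨hp.1, hy⟩)).2.le
  have h2 : Tendsto (fun p : ℝ × ℝ => w p.1 x) (𝓝 (t, x)) (𝓝 (w t x)) :=
    (h.differentiable_time t ht x).continuousAt.tendsto.comp continuous_fst.continuousAt.tendsto
  simpa [ContinuousAt] using h1.add h2

lemma hasDerivAt_time {g w₀ : ℝ → ℝ} {w : ℝ → ℝ → ℝ} (h : IsFKPPSolution g w₀ w) {t : ℝ}
    (ht : 0 < t) (x : ℝ) : HasDerivAt (fun s => w s x)
      (1 / 2 * deriv (deriv (w t)) x + w t x * (1 - w t x) * g t) t := by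
  have := (h.differentiable_time t ht x).hasDerivAt
  rwa [h.equation t ht x, iteratedDeriv_succ, iteratedDeriv_one] at this

end IsFKPPSolution

namespace BBM

/-- A Gaussian solution of the heat equation used as a barrier. -/
noncomputable def barrier (δ t x : ℝ) : ℝ := Real.exp (-(Real.log (t + δ) / 2) - x ^ 2 / (2 * (t + δ)))

lemma barrier_pos (δ t x : ℝ) : 0 < barrier δ t x := Real.exp_pos _

lemma hasDerivAt_barrier_time {δ t : ℝ} (h : 0 < t + δ) (x : ℝ) :
    HasDerivAt (fun s => barrier δ s x)
      (barrier δ t x * (x ^ 2 / (2 * (t + δ) ^ 2) - 1 / (2 * (t + δ)))) t := by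
  have h0 : HasDerivAt (fun s : ℝ => s + δ) 1 t := (hasDerivAt_id t).add_const δ
  have h1 := ((h0.log h.ne').div_const 2).neg
  have h2 := (h0.const_mul 2).fun_inv (by positivity) |>.const_mul (x ^ 2)
  refine ((h1.sub h2).exp).congr_deriv ?_
  simp only [barrier, div_eq_mul_inv, Pi.sub_apply, Pi.neg_apply]
  congr 1
  field_simp
  ring

lemma hasDerivAt_barrier_space (δ t x : ℝ) :
    HasDerivAt (barrier δ t) (barrier δ t x * (-(x / (t + δ)))) x := by
  have h1 : HasDerivAt (fun z : ℝ => -(Real.log (t + δ) / 2) - z ^ 2 / (2 * (t + δ)))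
      (-(2 * x / (2 * (t + δ)))) x := by
    simpa using ((hasDerivAt_pow 2 x).div_const (2 * (t + δ))).const_sub (-(Real.log (t + δ) / 2))
  refine h1.exp.congr_deriv ?_
  rw [mul_div_mul_left x _ two_ne_zero]
  rfl

lemma hasDerivAt_barrier_space_deriv {δ t : ℝ} (h : 0 < t + δ) (x : ℝ) :
    HasDerivAt (fun x => barrier δ t x * (-(x / (t + δ))))
      (barrier δ t x * (x ^ 2 / (t + δ) ^ 2 - 1 / (t + δ))) x := by
  refine ((hasDerivAt_barrier_space δ t x).mul ((hasDerivAt_id x).div_const (t + δ)).neg).congr_deriv ?_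
  simp only [id, Pi.neg_apply]
  field_simp
  ring

lemma continuousAt_barrier {δ t : ℝ} (h : 0 < t + δ) (x : ℝ) :
    ContinuousAt (fun p : ℝ × ℝ => barrier δ p.1 p.2) (t, x) := by
  unfold barrier
  have h1 : ContinuousAt (fun p : ℝ × ℝ => Real.log (p.1 + δ)) (t, x) :=
    ContinuousAt.log (by fun_prop) h.ne'
  have h2 : ContinuousAt (fun p : ℝ × ℝ => p.2 ^ 2 / (2 * (p.1 + δ))) (t, x) :=
    ContinuousAt.div (by fun_prop) (by fun_prop) (by simp; linarith)
  exact ((h1.div_const 2).neg.sub h2).rexp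

/-- The difference `Ψ` of the two sides cannot have a positive maximum. The barrier solves the heat
equation, `1 + x² + 2t` is a strict supersolution, and the factor `exp (-(K t))` absorbs the
reaction term, whose difference is `g (w₁ - w₂) (1 - w₁ - w₂)`. -/
lemma sub_le_barrier {g w₀ : ℝ → ℝ} {w₁ w₂ : ℝ → ℝ → ℝ}
    (h₁ : IsFKPPSolution g w₀ w₁) (h₂ : IsFKPPSolution g w₀ w₂)
    (hw₀ : ∀ x ≠ 0, ContinuousAt w₀ x) {T M K : ℝ}
    (hM : ∀ t, 0 ≤ t → t ≤ T → ∀ x, |w₁ t x - w₂ t x| ≤ M)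
    (hK0 : 0 ≤ K)
    (hK : ∀ t, 0 ≤ t → t ≤ T → ∀ x, g t * (1 - w₁ t x - w₂ t x) ≤ K)
    {δ η : ℝ} (hδ : 0 < δ) (hη : 0 < η) {t₀ : ℝ} (ht₀ : 0 ≤ t₀) (htT : t₀ ≤ T) (x₀ : ℝ) :
    Real.exp (-(K * t₀)) * (w₁ t₀ x₀ - w₂ t₀ x₀)
      ≤ 2 * M * Real.exp (Real.log δ / 2) * barrier δ t₀ x₀ + η * (1 + x₀ ^ 2 + 2 * t₀) := by
  have hT : 0 ≤ T := ht₀.trans htT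
  have hM0 : 0 ≤ M := (abs_nonneg _).trans (hM 0 le_rfl hT 0)
  set A := 2 * M * Real.exp (Real.log δ / 2) with hA
  have hA0 : 0 ≤ A := by positivity
  set Ψ : ℝ × ℝ → ℝ := fun p => Real.exp (-(K * p.1)) * (w₁ p.1 p.2 - w₂ p.1 p.2)
    - A * barrier δ p.1 p.2 - η * (1 + p.2 ^ 2 + 2 * p.1) with hΨ
  suffices h : Ψ (t₀, x₀) ≤ 0 by
    simp only [hΨ] at h
    linarith
  by_contra! hpos
  have hdM : ∀ t, 0 ≤ t → t ≤ T → ∀ x, Real.exp (-(K * t)) * (w₁ t x - w₂ t x) ≤ M := by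
    intro t ht htT x
    have he : Real.exp (-(K * t)) ≤ 1 := Real.exp_le_one_iff.2 (by nlinarith [mul_nonneg hK0 ht])
    calc _ ≤ Real.exp (-(K * t)) * M :=
          mul_le_mul_of_nonneg_left ((le_abs_self _).trans (hM t ht htT x)) (Real.exp_nonneg _)
      _ ≤ 1 * M := mul_le_mul_of_nonneg_right he hM0
      _ = M := one_mul M
  -- `exp (log δ / 2) = √δ` normalises the barrier to `1` at the origin. Multiplied by `2 M` it
  -- exceeds `M` nearby, so `Ψ` is negative around the one point where it may be discontinuous.
  obtain ⟨N, hNopen, hN0, hN⟩ : ∃ N : Set (ℝ × ℝ), IsOpen N ∧ (0, 0) ∈ N ∧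
      ∀ p ∈ N, 0 ≤ p.1 → p.1 ≤ T → Ψ p < 0 := by
    have hb0 : Real.exp (Real.log δ / 2) * barrier δ 0 0 = 1 := by
      rw [barrier, ← Real.exp_add]
      simp
    have hc : ContinuousAt (fun p : ℝ × ℝ => Real.exp (Real.log δ / 2) * barrier δ p.1 p.2) (0, 0) :=
      (continuousAt_barrier (by simpa using hδ) 0).const_mul _
    have hev : ∀ᶠ p : ℝ × ℝ in 𝓝 (0, 0), 1 / 2 < Real.exp (Real.log δ / 2) * barrier δ p.1 p.2 :=
      hc.eventually_const_lt (by simp only [hb0]; norm_num)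
    obtain ⟨N, hN, hNo, hN0⟩ := eventually_nhds_iff.1 hev
    refine ⟨N, hNo, hN0, fun p hp hp0 hpT => ?_⟩
    have h1 := hN p hp
    have h2 := hdM p.1 hp0 hpT p.2
    have h3 : 0 < η * (1 + p.2 ^ 2 + 2 * p.1) := by positivity
    simp only [hΨ, hA]
    nlinarith
  -- For `|x| ≥ R` the quadratic term alone exceeds the bound `M`, so a positive maximum lies
  -- strictly inside the box.
  obtain ⟨R, hR, hRx⟩ : ∃ R : ℝ, M < η * R ^ 2 ∧ |x₀| < R := by
    refine ⟨|x₀| + 1 + M / η, ?_, by have := div_nonneg hM0 hη.le; linarith⟩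
    have h1 : 0 ≤ M / η := div_nonneg hM0 hη.le
    have h2 : M / η < (|x₀| + 1 + M / η) ^ 2 := by nlinarith [abs_nonneg x₀]
    rwa [div_lt_iff₀' hη] at h2
  have hR0 : 0 < R := (abs_nonneg _).trans_lt hRx
  set S : Set (ℝ × ℝ) := Icc 0 T ×ˢ Icc (-R) R
  have hScomp : IsCompact (S \ N) := (isCompact_Icc.prod isCompact_Icc).diff hNopen
  have hinit : ∀ x, Ψ (0, x) < 0 := by
    intro x
    simp only [hΨ, h₁.initial, h₂.initial]
    have h1 := mul_nonneg hA0 (barrier_pos δ 0 x).le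
    have h3 : 0 < η * (1 + x ^ 2 + 2 * 0) := by positivity
    simp only [sub_self, mul_zero, zero_sub]
    linarith
  have hcont : ContinuousOn Ψ (S \ N) := by
    rintro ⟨t, x⟩ ⟨⟨ht, hx⟩, hN'⟩
    have hb : ContinuousAt (fun p : ℝ × ℝ => barrier δ p.1 p.2) (t, x) :=
      continuousAt_barrier (by simp at ht; linarith) x
    have hw : ContinuousWithinAt (fun p : ℝ × ℝ => w₁ p.1 p.2 - w₂ p.1 p.2) (S \ N) (t, x) := by
      rcases eq_or_lt_of_le ht.1 with h0 | h0
      · simp only at h0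
        subst h0
        have hx0 : x ≠ 0 := by
          rintro rfl
          exact hN' hN0
        exact ((h₁.continuous_initial x (hw₀ x hx0)).sub
          (h₂.continuous_initial x (hw₀ x hx0))).mono fun p hp => hp.1.1.1
      · exact ((h₁.continuousAt_uncurry h0 x).sub (h₂.continuousAt_uncurry h0 x)).continuousWithinAt
    refine ((ContinuousWithinAt.mul (by fun_prop) hw).sub (hb.continuousWithinAt.const_mul A)).sub ?_
    fun_prop
  have hmem : (t₀, x₀) ∈ S \ N := by
    refine ⟨⟨⟨ht₀, htT⟩, abs_le.1 hRx.le⟩, fun h => ?_⟩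
    exact absurd (hN _ h ht₀ htT) (not_lt.2 hpos.le)
  obtain ⟨⟨t, x⟩, ⟨⟨ht, hx⟩, htxN⟩, hmax⟩ := hScomp.exists_isMaxOn ⟨_, hmem⟩ hcont
  simp only at ht hx
  have hpos' : 0 < Ψ (t, x) := hpos.trans_le (hmax hmem)
  have hmax' : ∀ p ∈ S, Ψ p ≤ Ψ (t, x) := by
    intro p hp
    by_cases hpN : p ∈ N
    · exact (hN p hpN hp.1.1 hp.1.2).le.trans hpos'.le
    · exact hmax ⟨hp, hpN⟩
  have ht0 : 0 < t := by
    refine lt_of_le_of_ne ht.1 ?_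
    rintro rfl
    exact absurd (hinit x) (not_lt.2 hpos'.le)
  have hxR : x ^ 2 < R ^ 2 := by
    by_contra! hge
    have h1 := hdM t ht.1 ht.2 x
    have h2 := mul_nonneg hA0 (barrier_pos δ t x).le
    have h3 : η * R ^ 2 ≤ η * x ^ 2 := mul_le_mul_of_nonneg_left hge hη.le
    have h4 : 0 < η * (1 + 2 * t) := by positivity
    simp only [hΨ] at hpos'
    nlinarith
  have hxR' : |x| < R := by
    have := sq_lt_sq.1 hxR
    rwa [abs_of_pos hR0] at this
  have htδ : 0 < t + δ := by linarith
  have hd1 := (h₁.contDiff_space t ht0)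
  have hd2 := (h₂.contDiff_space t ht0)
  have htime : HasDerivAt (fun s => Ψ (s, x)) (Real.exp (-(K * t)) * (-K) * (w₁ t x - w₂ t x)
      + Real.exp (-(K * t)) * ((1 / 2 * deriv (deriv (w₁ t)) x + w₁ t x * (1 - w₁ t x) * g t)
        - (1 / 2 * deriv (deriv (w₂ t)) x + w₂ t x * (1 - w₂ t x) * g t))
      - A * (barrier δ t x * (x ^ 2 / (2 * (t + δ) ^ 2) - 1 / (2 * (t + δ)))) - η * 2) t := by
    have he : HasDerivAt (fun s => Real.exp (-(K * s))) (Real.exp (-(K * t)) * (-K)) t := by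
      simpa using ((hasDerivAt_id t).const_mul K).neg.exp
    have hl : HasDerivAt (fun s => η * (1 + x ^ 2 + 2 * s)) (η * 2) t := by
      simpa using (((hasDerivAt_id t).const_mul 2).const_add (1 + x ^ 2)).const_mul η
    exact ((he.mul ((h₁.hasDerivAt_time ht0 x).sub (h₂.hasDerivAt_time ht0 x))).sub
      ((hasDerivAt_barrier_time htδ x).const_mul A)).sub hl
  have htime0 := htime.nonneg_of_le_left ht0 fun s hs =>
    hmax' (s, x) ⟨⟨hs.1.le, hs.2.le.trans ht.2⟩, hx⟩
  have hspace : ∀ y, HasDerivAt (fun y => Ψ (t, y)) (Real.exp (-(K * t)) *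
      (deriv (w₁ t) y - deriv (w₂ t) y) - A * (barrier δ t y * (-(y / (t + δ)))) - η * (2 * y)) y := by
    intro y
    have hl : HasDerivAt (fun y => η * (1 + y ^ 2 + 2 * t)) (η * (2 * y)) y := by
      simpa using (((hasDerivAt_pow 2 y).const_add 1).add_const (2 * t)).const_mul η
    exact (((((hd1.differentiable two_ne_zero) y).hasDerivAt.sub
      ((hd2.differentiable two_ne_zero) y).hasDerivAt).const_mul (Real.exp (-(K * t)))).sub
      ((hasDerivAt_barrier_space δ t y).const_mul A)).sub hl
  have hspace2 : HasDerivAt (fun y => Real.exp (-(K * t)) *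
      (deriv (w₁ t) y - deriv (w₂ t) y) - A * (barrier δ t y * (-(y / (t + δ)))) - η * (2 * y))
      (Real.exp (-(K * t)) * (deriv (deriv (w₁ t)) x - deriv (deriv (w₂ t)) x)
        - A * (barrier δ t x * (x ^ 2 / (t + δ) ^ 2 - 1 / (t + δ))) - η * 2) x := by
    have hl : HasDerivAt (fun y : ℝ => η * (2 * y)) (η * 2) x := by
      simpa using ((hasDerivAt_id x).const_mul 2).const_mul η
    exact (((hd1.differentiable_deriv_two x).hasDerivAt.sub
      (hd2.differentiable_deriv_two x).hasDerivAt).const_mul (Real.exp (-(K * t))) |>.sub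
      ((hasDerivAt_barrier_space_deriv htδ x).const_mul A)).sub hl
  have hlm : IsLocalMax (fun y => Ψ (t, y)) x := by
    filter_upwards [Ioo_mem_nhds (abs_lt.1 hxR').1 (abs_lt.1 hxR').2] with y hy
    exact hmax' (t, y) ⟨ht, hy.1.le, hy.2.le⟩
  have hspace0 := deriv_deriv_nonpos_of_isLocalMax hlm (hspace x).continuousAt
  rw [funext fun y => (hspace y).deriv, hspace2.deriv] at hspace0
  have hd0 : 0 < Real.exp (-(K * t)) * (w₁ t x - w₂ t x) := by
    have h2 := mul_nonneg hA0 (barrier_pos δ t x).le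
    have h4 : 0 < η * (1 + x ^ 2 + 2 * t) := by positivity
    simp only [hΨ] at hpos'
    linarith
  -- At the maximum `∂ₜΨ - ½ ∂ₓₓΨ ≥ 0`. The barrier drops out of this combination, leaving `exp (-(K
  -- t)) (w₁ - w₂) (g (1 - w₁ - w₂) - K) - η ≤ -η`.
  have hKd := mul_nonneg (sub_nonneg.2 (hK t ht.1 ht.2 x)) hd0.le
  have hb2 : x ^ 2 / (2 * (t + δ) ^ 2) - 1 / (2 * (t + δ))
      = 1 / 2 * (x ^ 2 / (t + δ) ^ 2 - 1 / (t + δ)) := by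
    field_simp
  rw [hb2] at htime0
  nlinarith

theorem _root_.IsFKPPSolution.le {g w₀ : ℝ → ℝ} {w₁ w₂ : ℝ → ℝ → ℝ}
    (h₁ : IsFKPPSolution g w₀ w₁) (h₂ : IsFKPPSolution g w₀ w₂)
    (hw₀ : ∀ x ≠ 0, ContinuousAt w₀ x) {G : ℝ} (hg : ∀ t, 0 ≤ t → |g t| ≤ G)
    {t : ℝ} (ht : 0 < t) (x : ℝ) : w₁ t x ≤ w₂ t x := by
  obtain ⟨C₁, hC₁⟩ := h₁.bounded t
  obtain ⟨C₂, hC₂⟩ := h₂.bounded t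
  have hG0 : 0 ≤ G := (abs_nonneg _).trans (hg 0 le_rfl)
  have hC0 : 0 ≤ C₁ := (abs_nonneg _).trans (hC₁ 0 le_rfl ht.le 0)
  have hC0' : 0 ≤ C₂ := (abs_nonneg _).trans (hC₂ 0 le_rfl ht.le 0)
  set M := C₁ + C₂
  set K := G * (1 + C₁ + C₂)
  -- For fixed `t > 0` the barrier is at most `t^(-1/2) = barrier 0 t 0` for every `δ > 0` and every
  -- `x`. Its coefficient is a multiple of `√δ`, so taking `η = δ → 0` kills the right-hand side.
  have key : ∀ δ : ℝ, 0 < δ → ∀ η : ℝ, 0 < η → Real.exp (-(K * t)) * (w₁ t x - w₂ t x)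
      ≤ 2 * M * Real.exp (Real.log δ / 2) * barrier 0 t 0 + η * (1 + x ^ 2 + 2 * t) := by
    intro δ hδ η hη
    refine (sub_le_barrier h₁ h₂ hw₀ (T := t) (M := M) (K := K) ?_ ?_ ?_ hδ hη ht.le le_rfl x).trans ?_
    · intro s hs hst y
      exact (abs_sub _ _).trans (add_le_add (hC₁ s hs hst y) (hC₂ s hs hst y))
    · positivity
    · intro s hs hst y
      refine (le_abs_self _).trans ?_
      rw [abs_mul]
      refine mul_le_mul (hg s hs) ?_ (abs_nonneg _) hG0
      have h1 := abs_le.1 (hC₁ s hs hst y)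
      have h2 := abs_le.1 (hC₂ s hs hst y)
      exact abs_le.2 ⟨by linarith, by linarith⟩
    · refine add_le_add_left (mul_le_mul_of_nonneg_left ?_ (by positivity)) _
      unfold barrier
      refine Real.exp_le_exp.2 ?_
      have h1 : Real.log t ≤ Real.log (t + δ) := Real.log_le_log ht (by linarith)
      have h2 : 0 ≤ x ^ 2 / (2 * (t + δ)) := by positivity
      simp only [add_zero, ne_eq, OfNat.ofNat_ne_zero, not_false_eq_true, zero_pow, zero_div]
      linarith
  have hlimδ : Tendsto (fun δ : ℝ => 2 * M * Real.exp (Real.log δ / 2) * barrier 0 t 0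
      + δ * (1 + x ^ 2 + 2 * t)) (𝓝[>] 0) (𝓝 (2 * M * 0 * barrier 0 t 0 + 0 * (1 + x ^ 2 + 2 * t))) := by
    refine Tendsto.add (Tendsto.mul_const _ (Tendsto.const_mul _ ?_)) (Tendsto.mul_const _ ?_)
    · exact Real.tendsto_exp_atBot.comp
        (Real.tendsto_log_nhdsGT_zero.atBot_div_const two_pos)
    · exact tendsto_id.mono_left nhdsWithin_le_nhds
  have hle : Real.exp (-(K * t)) * (w₁ t x - w₂ t x) ≤ 0 := by
    refine (ge_of_tendsto hlimδ ?_).trans_eq (by ring)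
    filter_upwards [self_mem_nhdsWithin] with δ hδ using key δ hδ δ hδ
  have := nonpos_of_mul_nonpos_right hle (Real.exp_pos _)
  linarith

/-! ### Mild solutions and the restart formula -/

/-- Bounded mild solutions of `∂ₜ u = ½ ∂ₓₓ u + u ^ 2 - u`. -/
structure IsMildSolution (f₀ : ℝ → ℝ) (u : ℝ → ℝ → ℝ) : Prop where
  measurable : Measurable (Function.uncurry u)
  bound : ∀ t x, |u t x| ≤ 1
  measurable_initial : Measurable f₀
  bound_initial : ∀ x, |f₀ x| ≤ 1
  equation : ∀ t, 0 ≤ t → ∀ x, u t x = Real.exp (-t) * heatOp t f₀ x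
    + ∫ s in 0..t, Real.exp (-(t - s)) * heatOp (t - s) (fun y => u s y ^ 2) x

lemma intervalIntegrable_of_bounded {f : ℝ → ℝ} (hf : Measurable f) {a b C : ℝ}
    (hb : ∀ s ∈ uIoc a b, |f s| ≤ C) : IntervalIntegrable f volume a b := by
  rw [intervalIntegrable_iff]
  have : IsFiniteMeasure (volume.restrict (uIoc a b)) := ⟨by simp [uIoc]⟩
  refine Integrable.of_bound hf.aestronglyMeasurable C ?_
  filter_upwards [ae_restrict_mem measurableSet_uIoc] with s hs using hb s hs

lemma measurable_source {q : ℝ → ℝ → ℝ} (hq : Measurable (Function.uncurry q)) (t x : ℝ) :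
    Measurable fun s => Real.exp (-(t - s)) * heatOp (t - s) (q s) x :=
  (by fun_prop : Measurable fun s : ℝ => Real.exp (-(t - s))).mul
    (measurable_heatOp (by fun_prop) measurable_const hq)

lemma abs_source_le {q : ℝ → ℝ → ℝ} {C : ℝ} (hb : ∀ s y, |q s y| ≤ C) {s t : ℝ} (hst : s ≤ t)
    (x : ℝ) : |Real.exp (-(t - s)) * heatOp (t - s) (q s) x| ≤ C := by
  have h1 : Real.exp (-(t - s)) ≤ 1 := Real.exp_le_one_iff.2 (by linarith)
  rw [abs_mul, abs_of_pos (Real.exp_pos _)]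
  have h2 := abs_heatOp_le (t := t - s) (x := x) (hb s)
  nlinarith [abs_nonneg (heatOp (t - s) (q s) x), Real.exp_pos (-(t - s))]

lemma intervalIntegrable_source {q : ℝ → ℝ → ℝ} (hq : Measurable (Function.uncurry q)) {C : ℝ}
    (hb : ∀ s y, |q s y| ≤ C) {a b t : ℝ} (ha : a ≤ t) (hbt : b ≤ t) (x : ℝ) :
    IntervalIntegrable (fun s => Real.exp (-(t - s)) * heatOp (t - s) (q s) x) volume a b :=
  intervalIntegrable_of_bounded (measurable_source hq t x) fun _ hs =>
    abs_source_le hb (hs.2.trans (max_le ha hbt)) x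

namespace IsMildSolution

variable {f₀ : ℝ → ℝ} {u : ℝ → ℝ → ℝ}

lemma measurable_sq (hu : IsMildSolution f₀ u) :
    Measurable (Function.uncurry fun s y => u s y ^ 2) := hu.measurable.pow_const 2

lemma bound_sq (hu : IsMildSolution f₀ u) (s y : ℝ) : |u s y ^ 2| ≤ 1 := by
  rw [abs_pow]
  exact pow_le_one₀ (abs_nonneg _) (hu.bound s y)

lemma measurable_slice (hu : IsMildSolution f₀ u) (s : ℝ) : Measurable (u s) :=
  hu.measurable.comp measurable_prodMk_left

/-- The Markov property of mild solutions. -/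
lemma restart (hu : IsMildSolution f₀ u) {s t : ℝ} (hs : 0 ≤ s) (hst : s ≤ t) (x : ℝ) :
    u t x = Real.exp (-(t - s)) * heatOp (t - s) (u s) x
      + ∫ r in s..t, Real.exp (-(t - r)) * heatOp (t - r) (fun y => u r y ^ 2) x := by
  have hts : 0 ≤ t - s := sub_nonneg.2 hst
  have hq := hu.measurable_sq
  have hmeas : Measurable fun p : ℝ × ℝ =>
      Real.exp (-(s - p.1)) * heatOp (s - p.1) (fun y => u p.1 y ^ 2) (x - p.2) := by
    refine (by fun_prop : Measurable fun p : ℝ × ℝ => Real.exp (-(s - p.1))).mul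
      (measurable_heatOp (f := fun (p : ℝ × ℝ) y => u p.1 y ^ 2) (by fun_prop) (by fun_prop) ?_)
    exact hq.comp (by fun_prop : Measurable fun p : (ℝ × ℝ) × ℝ => (p.1.1, p.2))
  have hprod : Integrable (Function.uncurry fun r y =>
      Real.exp (-(s - r)) * heatOp (s - r) (fun y => u r y ^ 2) (x - y))
      ((volume.restrict (uIoc 0 s)).prod (gaussianReal 0 (t - s).toNNReal)) := by
    have : IsFiniteMeasure (volume.restrict (uIoc 0 s)) := ⟨by simp [uIoc]⟩
    refine Integrable.of_bound hmeas.aestronglyMeasurable 1 ?_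
    have h1 : ∀ᵐ p ∂((volume.restrict (uIoc 0 s)).prod (gaussianReal 0 (t - s).toNNReal)),
        p.1 ∈ uIoc 0 s :=
      Measure.quasiMeasurePreserving_fst.ae (ae_restrict_mem measurableSet_uIoc)
    filter_upwards [h1] with p hp
    exact abs_source_le (q := fun s y => u s y ^ 2) hu.bound_sq (hp.2.trans (max_le hs le_rfl)) (x - p.2)
  -- Apply the semigroup to the mild equation at time `s`; Fubini and the semigroup property merge
  -- the two Gaussian averages.
  have h1 : heatOp (t - s) (u s) x = Real.exp (-s) * heatOp t f₀ x
      + ∫ r in 0..s, Real.exp (-(s - r)) * heatOp (t - r) (fun y => u r y ^ 2) x := by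
    have e1 : heatOp (t - s) (u s) x = heatOp (t - s) (fun y => Real.exp (-s) * heatOp s f₀ y
      + ∫ r in 0..s, Real.exp (-(s - r)) * heatOp (s - r) (fun y => u r y ^ 2) y) x := by
      congr 1
      ext y
      exact hu.equation s hs y
    have e2 : ∀ f, heatOp (t - s) f x = ∫ y, f (x - y) ∂(gaussianReal 0 (t - s).toNNReal) :=
      fun _ => rfl
    rw [e1, e2, integral_add]
    · rw [integral_const_mul]
      congr 1
      · rw [← e2 (heatOp s f₀), heatOp_heatOp hts hs hu.measurable_initial hu.bound_initial x,
          sub_add_cancel]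
      · rw [← intervalIntegral_integral_swap hprod]
        refine intervalIntegral.integral_congr fun r hr => ?_
        rw [uIcc_of_le hs] at hr
        rw [integral_const_mul]
        congr 1
        refine (heatOp_heatOp hts (sub_nonneg.2 hr.2) (hq.comp measurable_prodMk_left)
          (hu.bound_sq r) x).trans ?_
        rw [sub_add_sub_cancel]
        rfl
    · exact (integrable_comp_gaussianReal (measurable_heatOp (f := fun _ => f₀) measurable_const
        measurable_id (hu.measurable_initial.comp measurable_snd)) (fun y => abs_heatOp_le hu.bound_initial)
        _ x).const_mul _
    · have := hprod.integral_prod_right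
      simpa only [Function.uncurry, uIoc_of_le hs, ← intervalIntegral.integral_of_le hs] using this
  have h2 : ∫ r in 0..s, Real.exp (-(t - r)) * heatOp (t - r) (fun y => u r y ^ 2) x
      = Real.exp (-(t - s)) *
        ∫ r in 0..s, Real.exp (-(s - r)) * heatOp (t - r) (fun y => u r y ^ 2) x := by
    rw [← intervalIntegral.integral_const_mul]
    congr 1
    ext r
    rw [← mul_assoc, ← Real.exp_add]
    ring_nf
  rw [hu.equation t (hs.trans hst) x, ← intervalIntegral.integral_add_adjacent_intervals
    (intervalIntegrable_source hq hu.bound_sq (hs.trans hst) hst x)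
    (intervalIntegrable_source hq hu.bound_sq hst le_rfl x), h2, h1, mul_add, ← mul_assoc,
    ← Real.exp_add]
  ring_nf

/-! ### Smoothing in space -/

/-- The source term obtained by averaging `restart` over restart times in `(c, d]`. -/
noncomputable def averagedSource (u : ℝ → ℝ → ℝ) (c d : ℝ) (p : ℝ × ℝ) : ℝ :=
  (d - c)⁻¹ * ((Ioc c d).indicator (fun _ => u p.1 p.2) p.1
    + max 0 (min d p.1 - c) * u p.1 p.2 ^ 2)

lemma measurable_averagedSource (hu : IsMildSolution f₀ u) (c d : ℝ) :
    Measurable (averagedSource u c d) := by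
  have h1 : Measurable fun p : ℝ × ℝ => (Ioc c d).indicator (fun _ => u p.1 p.2) p.1 :=
    Measurable.ite (measurable_fst measurableSet_Ioc) hu.measurable measurable_const
  exact (h1.add ((by fun_prop : Measurable fun p : ℝ × ℝ => max 0 (min d p.1 - c)).mul
    hu.measurable_sq)).const_mul _

lemma abs_averagedSource_le (hu : IsMildSolution f₀ u) {c d : ℝ} (hcd : c < d) (p : ℝ × ℝ) :
    |averagedSource u c d p| ≤ (d - c)⁻¹ + 1 := by
  have hdc : 0 < d - c := sub_pos.2 hcd
  rw [averagedSource, abs_mul, abs_of_pos (inv_pos.2 hdc)]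
  have h1 : |(Ioc c d).indicator (fun _ => u p.1 p.2) p.1| ≤ 1 := by
    by_cases h : p.1 ∈ Ioc c d
    · simpa [h] using hu.bound p.1 p.2
    · simp [h]
  have h2 : |max 0 (min d p.1 - c) * u p.1 p.2 ^ 2| ≤ (d - c) * 1 := by
    rw [abs_mul, abs_of_nonneg (le_max_left _ _)]
    exact mul_le_mul (max_le hdc.le (sub_le_sub_right (min_le_left _ _) _)) (hu.bound_sq _ _)
      (abs_nonneg _) hdc.le
  calc _ ≤ (d - c)⁻¹ * (1 + (d - c) * 1) := by
        refine mul_le_mul_of_nonneg_left ((abs_add_le _ _).trans (add_le_add h1 h2)) ?_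
        exact (inv_pos.2 hdc).le
    _ = (d - c)⁻¹ + 1 := by field_simp

/-- In `restart` the term with `u s` is an integral over space only. Averaging over `s ∈ (c, d]`
turns it into a space-time integral, so that all of `u t x` is one convolution, with a source that
is the same for all `t ≥ d`. -/
lemma eq_conv_heatKer (hu : IsMildSolution f₀ u) {c d t : ℝ} (hc : 0 ≤ c) (hcd : c < d)
    (hdt : d ≤ t) (x : ℝ) : u t x = conv heatKer (averagedSource u c d) (t, x) := by
  have hdc : 0 < d - c := sub_pos.2 hcd
  have hct : c ≤ t := hcd.le.trans hdt
  set F : ℝ → ℝ := fun r => Real.exp (-(t - r)) * heatOp (t - r) (fun y => u r y ^ 2) x with hF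
  set H : ℝ → ℝ := fun s => Real.exp (-(t - s)) * heatOp (t - s) (u s) x with hH
  have hFm : Measurable F := measurable_source hu.measurable_sq t x
  have hFb : ∀ r ≤ t, |F r| ≤ 1 := fun r hr => abs_source_le (q := fun s y => u s y ^ 2) hu.bound_sq hr x
  have hHi : ∀ a b, a ≤ t → b ≤ t → IntervalIntegrable H volume a b := fun a b ha hb =>
    intervalIntegrable_source hu.measurable hu.bound ha hb x
  have hFi : ∀ a b, a ≤ t → b ≤ t → IntervalIntegrable F volume a b := fun a b ha hb =>
    intervalIntegrable_source hu.measurable_sq hu.bound_sq ha hb x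
  -- After Fubini, `F r` is weighted by the length of the set of restart times in `(c, d]` that
  -- precede `r`.
  have hswap : ∫ s in c..d, ∫ r in s..t, F r = ∫ r in c..t, max 0 (min d r - c) * F r := by
    have e1 : ∫ s in c..d, ∫ r in s..t, F r
        = ∫ s in c..d, ∫ r in c..t, (Ioi s).indicator F r := by
      refine intervalIntegral.integral_congr fun s hs => ?_
      rw [uIcc_of_le hcd.le] at hs
      rw [intervalIntegral.integral_of_le (hs.2.trans hdt), intervalIntegral.integral_of_le hct,
        setIntegral_indicator measurableSet_Ioi]
      congr 2
      ext r
      simp only [mem_Ioc, mem_inter_iff, mem_Ioi]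
      constructor
      · exact fun h => ⟨⟨hs.1.trans_lt h.1, h.2⟩, h.1⟩
      · exact fun h => ⟨h.2, h.1.2⟩
    have hI : Integrable (Function.uncurry fun s r => (Ioi s).indicator F r)
        ((volume.restrict (uIoc c d)).prod (volume.restrict (Ioc c t))) := by
      have : IsFiniteMeasure (volume.restrict (uIoc c d)) := ⟨by simp [uIoc]⟩
      have hm : Measurable (Function.uncurry fun s r => (Ioi s).indicator F r) :=
        Measurable.ite (measurableSet_lt measurable_fst measurable_snd) (hFm.comp measurable_snd)
          measurable_const
      refine Integrable.of_bound hm.aestronglyMeasurable 1 ?_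
      have h1 : ∀ᵐ p ∂((volume.restrict (uIoc c d)).prod (volume.restrict (Ioc c t))),
          p.2 ∈ Ioc c t :=
        Measure.quasiMeasurePreserving_snd.ae (ae_restrict_mem measurableSet_Ioc)
      filter_upwards [h1] with p hp
      by_cases h : p.2 ∈ Ioi p.1
      · simpa [Function.uncurry, h] using hFb p.2 hp.2
      · simp [Function.uncurry, h]
    rw [e1]
    simp only [intervalIntegral.integral_of_le hct]
    rw [intervalIntegral_integral_swap hI]
    refine setIntegral_congr_fun measurableSet_Ioc fun r hr => ?_
    rw [intervalIntegral.integral_of_le hcd.le]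
    have e2 : (fun s => (Ioi s).indicator F r) = (Iio r).indicator fun _ => F r := by
      ext s
      simp [indicator_apply]
    rw [e2, setIntegral_indicator measurableSet_Iio, setIntegral_const, smul_eq_mul]
    congr 1
    have e3 : volume (Ioc c d ∩ Iio r) = ENNReal.ofReal (min d r - c) := by
      rcases lt_or_ge d r with h | h
      · rw [inter_eq_left.2 fun s hs => hs.2.trans_lt h, Real.volume_Ioc, min_eq_left h.le]
      · rw [min_eq_right h, ← Real.volume_Ioo]
        congr 1
        ext s
        simp only [mem_inter_iff, mem_Ioc, mem_Iio, mem_Ioo]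
        exact ⟨fun hs => ⟨hs.1.1, hs.2⟩, fun hs => ⟨⟨hs.1, (hs.2.trans_le h).le⟩, hs.2⟩⟩
    rw [measureReal_def, e3, ENNReal.toReal_ofReal', max_comm]
  have hRint : IntervalIntegrable (fun s => ∫ r in s..t, F r) volume c d := by
    have h0 : ContinuousOn (fun s => ∫ r in s..t, F r) (uIcc c t) :=
      intervalIntegral.continuousOn_primitive_interval_left
        ((intervalIntegrable_iff' (by simp)).1 (hFi c t hct le_rfl))
    refine (h0.mono ?_).intervalIntegrable
    rw [uIcc_of_le hcd.le, uIcc_of_le hct]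
    exact Icc_subset_Icc_right hdt
  have havg : (d - c) * u t x = (∫ s in c..d, H s) + ∫ r in c..t, max 0 (min d r - c) * F r := by
    rw [← hswap, ← intervalIntegral.integral_add (hHi c d hct hdt) hRint, ← smul_eq_mul,
      ← intervalIntegral.integral_const]
    refine intervalIntegral.integral_congr fun s hs => ?_
    rw [uIcc_of_le hcd.le] at hs
    exact hu.restart (hc.trans hs.1) (hs.2.trans hdt) x
  have hQ := conv_heatKer (hu.measurable_averagedSource c d) (hu.abs_averagedSource_le hcd) t x
  have hsub : ∫ r in Ioi 0, Real.exp (-r) * heatOp r (fun y => averagedSource u c d (t - r, y)) x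
      = ∫ s in Iio t, Real.exp (-(t - s)) * heatOp (t - s) (fun y => averagedSource u c d (s, y)) x := by
    have hmp := Measure.measurePreserving_sub_left (volume : Measure ℝ) t
    have := hmp.setIntegral_preimage_emb (MeasurableEquiv.subLeft t).measurableEmbedding
      (fun r => Real.exp (-r) * heatOp r (fun y => averagedSource u c d (t - r, y)) x) (Ioi 0)
    rw [← this]
    have e : (fun s => t - s) ⁻¹' Ioi 0 = Iio t := by
      ext s
      simp
    rw [e]
    simp only [sub_sub_cancel]
  -- The source vanishes up to time `c`, and times from `t` on were already removed because the
  -- kernel is zero at nonpositive times.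
  have hsrc : ∀ s ∈ Iio t, Real.exp (-(t - s)) *
      heatOp (t - s) (fun y => averagedSource u c d (s, y)) x
      = (Ioc c t).indicator (fun s => (d - c)⁻¹ * ((Ioc c d).indicator H s
        + max 0 (min d s - c) * F s)) s := by
    intro s hs
    by_cases hsc : c < s
    · rw [indicator_of_mem (show s ∈ Ioc c t from ⟨hsc, (mem_Iio.1 hs).le⟩)]
      unfold averagedSource heatOp
      simp only
      rw [integral_const_mul, integral_add]
      · rw [integral_const_mul]
        by_cases hsd : s ∈ Ioc c d
        · simp only [indicator_of_mem hsd, hH, hF, heatOp]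
          ring
        · simp only [indicator_of_notMem hsd, hH, hF, heatOp]
          simp
          ring
      · by_cases hsd : s ∈ Ioc c d
        · simpa [indicator_of_mem hsd] using
            integrable_comp_gaussianReal (hu.measurable_slice s) (hu.bound s) _ x
        · simp [indicator_of_notMem hsd]
      · exact (integrable_comp_gaussianReal ((hu.measurable_slice s).pow_const 2)
          (hu.bound_sq s) _ x).const_mul _
    · have h1 : s ∉ Ioc c t := fun h => hsc h.1
      have h2 : s ∉ Ioc c d := fun h => hsc h.1
      have h3 : min d s - c ≤ 0 := sub_nonpos.2 ((min_le_right _ _).trans (not_lt.1 hsc))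
      simp [averagedSource, heatOp, h1, h2, max_eq_left h3]
  rw [hQ, hsub, setIntegral_congr_fun measurableSet_Iio hsrc, ← integral_Iic_eq_integral_Iio,
    setIntegral_indicator measurableSet_Ioc, inter_eq_right.2 Ioc_subset_Iic_self,
    integral_const_mul, integral_add, setIntegral_indicator measurableSet_Ioc,
    inter_eq_right.2 (Ioc_subset_Ioc_right hdt), ← intervalIntegral.integral_of_le hct,
    ← intervalIntegral.integral_of_le hcd.le, ← havg, inv_mul_cancel_left₀ hdc.ne']
  · rw [integrable_indicator_iff measurableSet_Ioc, IntegrableOn,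
      Measure.restrict_restrict measurableSet_Ioc, inter_eq_left.2 (Ioc_subset_Ioc_right hdt)]
    exact (intervalIntegrable_iff_integrableOn_Ioc_of_le hcd.le).1 (hHi c d hct hdt)
  · refine ((intervalIntegrable_iff_integrableOn_Ioc_of_le hct).1
      (intervalIntegrable_of_bounded (f := fun s => max 0 (min d s - c) * F s) (C := (d - c) * 1)
        ((by fun_prop : Measurable fun s : ℝ => max 0 (min d s - c)).mul hFm) fun s hs => ?_))
    rw [abs_mul, abs_of_nonneg (le_max_left _ _)]
    exact mul_le_mul (max_le hdc.le (sub_le_sub_right (min_le_left _ _) _))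
      (hFb s (hs.2.trans (max_le hct le_rfl))) (abs_nonneg _) hdc.le

end IsMildSolution

namespace IsMildSolution

variable {f₀ : ℝ → ℝ} {u : ℝ → ℝ → ℝ}

lemma exists_hasDerivAt_space (hu : IsMildSolution f₀ u) {a : ℝ} (ha : 0 < a) :
    ∃ (U₁ : ℝ × ℝ → ℝ) (C : ℝ), Continuous U₁ ∧ (∀ p, |U₁ p| ≤ C) ∧
      ∀ t, a ≤ t → ∀ x, HasDerivAt (u t) (U₁ (t, x)) x := by
  have hQm := hu.measurable_averagedSource 0 a
  have hQb := hu.abs_averagedSource_le ha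
  refine ⟨conv heatKerDeriv (averagedSource u 0 a), _, continuous_conv integrable_heatKerDeriv hQm hQb,
    abs_conv_le integrable_heatKerDeriv hQb, fun t ht x => ?_⟩
  exact (hasDerivAt_conv_left integrable_heatKer integrable_heatKerDeriv measurable_heatKerDeriv
    hQm hQb hasDerivAt_heatKer continuous_heatKerDeriv t x).congr_of_eventuallyEq
    (Eventually.of_forall fun y => hu.eq_conv_heatKer le_rfl ha ht y)

/-- From time `a` on, `u` has a bounded space derivative. Hence the source averaged over `(a, 2a]`
is differentiable in space: one derivative falls on the kernel, the other on the source, and only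
`heatKerDeriv` is needed. -/
lemma exists_hasDerivAt_space_two (hu : IsMildSolution f₀ u) {a : ℝ} (ha : 0 < a) :
    ∃ (U U₁ U₂ : ℝ × ℝ → ℝ) (C : ℝ), Continuous U ∧ Continuous U₁ ∧ Continuous U₂ ∧
      (∀ p, |U₂ p| ≤ C) ∧ ∀ t, 2 * a ≤ t → ∀ x, u t x = U (t, x) ∧
      HasDerivAt (u t) (U₁ (t, x)) x ∧ HasDerivAt (fun y => U₁ (t, y)) (U₂ (t, x)) x := by
  obtain ⟨V, C, hVc, hVb, hV⟩ := hu.exists_hasDerivAt_space ha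
  have ha2 : a < 2 * a := by linarith
  have hda : 0 < 2 * a - a := sub_pos.2 ha2
  have hC : 0 ≤ C := (abs_nonneg _).trans (hVb 0)
  have hQm := hu.measurable_averagedSource a (2 * a)
  have hQb := hu.abs_averagedSource_le ha2
  set Q' : ℝ × ℝ → ℝ := fun p => (2 * a - a)⁻¹ * ((Ioc a (2 * a)).indicator (fun _ => V p) p.1
    + max 0 (min (2 * a) p.1 - a) * (2 * u p.1 p.2 * V p)) with hQ'
  have hQ'm : Measurable Q' := by
    have h1 : Measurable fun p : ℝ × ℝ => (Ioc a (2 * a)).indicator (fun _ => V p) p.1 :=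
      Measurable.ite (measurable_fst measurableSet_Ioc) hVc.measurable measurable_const
    exact (h1.add ((by fun_prop : Measurable fun p : ℝ × ℝ => max 0 (min (2 * a) p.1 - a)).mul
      ((hu.measurable.const_mul 2).mul hVc.measurable))).const_mul _
  have hQ'b : ∀ p, |Q' p| ≤ (2 * a - a)⁻¹ * (C + (2 * a - a) * (2 * 1 * C)) := by
    intro p
    rw [hQ', abs_mul, abs_of_pos (inv_pos.2 hda)]
    refine mul_le_mul_of_nonneg_left ((abs_add_le _ _).trans (add_le_add ?_ ?_)) (inv_pos.2 hda).le
    · by_cases h : p.1 ∈ Ioc a (2 * a)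
      · simpa [h] using hVb p
      · simpa [h] using hC
    · rw [abs_mul, abs_of_nonneg (le_max_left _ _)]
      refine mul_le_mul (max_le hda.le (sub_le_sub_right (min_le_left _ _) _)) ?_
        (abs_nonneg _) hda.le
      rw [abs_mul, abs_mul, abs_two]
      exact mul_le_mul (mul_le_mul_of_nonneg_left (hu.bound _ _) zero_le_two) (hVb p)
        (abs_nonneg _) (by norm_num)
  have hQd : ∀ r z, HasDerivAt (fun z => averagedSource u a (2 * a) (r, z)) (Q' (r, z)) z := by
    intro r z
    by_cases hr : a < r
    · have hd := hV r hr.le z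
      have h1 : HasDerivAt (fun z => (Ioc a (2 * a)).indicator (fun _ => u r z) r)
          ((Ioc a (2 * a)).indicator (fun _ => V (r, z)) r) z := by
        by_cases h : r ∈ Ioc a (2 * a)
        · simpa [h] using hd
        · simpa [h] using hasDerivAt_const z (0 : ℝ)
      refine ((h1.add ((hd.fun_pow 2).const_mul (max 0 (min (2 * a) r - a)))).const_mul
        (2 * a - a)⁻¹).congr_deriv ?_
      simp [hQ']
    -- Before time `a` nothing is known about the differentiability of `u`, but there the source is
    -- identically zero.
    · have h1 : r ∉ Ioc a (2 * a) := fun h => hr h.1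
      have h2 : max 0 (min (2 * a) r - a) = 0 :=
        max_eq_left (sub_nonpos.2 ((min_le_right _ _).trans (not_lt.1 hr)))
      simp only [averagedSource, hQ', indicator_of_notMem h1, h2, zero_mul, add_zero, mul_zero]
      exact hasDerivAt_const z (0 : ℝ)
  refine ⟨_, _, conv heatKerDeriv Q', _, continuous_conv integrable_heatKer hQm hQb,
    continuous_conv integrable_heatKerDeriv hQm hQb,
    continuous_conv integrable_heatKerDeriv hQ'm hQ'b,
    abs_conv_le integrable_heatKerDeriv hQ'b, fun t ht x =>
    ⟨hu.eq_conv_heatKer ha.le ha2 ht x, ?_,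
      hasDerivAt_conv_right integrable_heatKerDeriv hQm hQb hQ'm hQ'b hQd t x⟩⟩
  exact (hasDerivAt_conv_left integrable_heatKer integrable_heatKerDeriv measurable_heatKerDeriv
    hQm hQb hasDerivAt_heatKer continuous_heatKerDeriv t x).congr_of_eventuallyEq
    (Eventually.of_forall fun y => hu.eq_conv_heatKer ha.le ha2 ht y)

lemma continuousAt_uncurry (hu : IsMildSolution f₀ u) {t : ℝ} (ht : 0 < t) (x : ℝ) :
    ContinuousAt (fun p : ℝ × ℝ => u p.1 p.2) (t, x) := by
  obtain ⟨U, U₁, U₂, C, hU, -, -, -, h⟩ := hu.exists_hasDerivAt_space_two (a := t / 4) (by positivity)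
  refine hU.continuousAt.congr ?_
  have hev : ∀ᶠ p : ℝ × ℝ in 𝓝 (t, x), 2 * (t / 4) < p.1 :=
    continuousAt_fst.eventually_const_lt (by simp only; linarith)
  filter_upwards [hev] with p hp using ((h p.1 hp.le p.2).1).symm

lemma contDiff_space (hu : IsMildSolution f₀ u) {t : ℝ} (ht : 0 < t) : ContDiff ℝ 2 (u t) := by
  obtain ⟨U, U₁, U₂, C, -, -, hU₂, -, h⟩ := hu.exists_hasDerivAt_space_two (a := t / 2) (by positivity)
  have h' := h t (by linarith)
  rw [show (2 : WithTop ℕ∞) = 1 + 1 by norm_num, contDiff_succ_iff_deriv]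
  refine ⟨fun x => (h' x).2.1.differentiableAt, by simp, ?_⟩
  rw [funext fun x => (h' x).2.1.deriv, contDiff_one_iff_deriv]
  refine ⟨fun x => (h' x).2.2.differentiableAt, ?_⟩
  rw [funext fun x => (h' x).2.2.deriv]
  exact hU₂.comp (by fun_prop)

lemma continuousAt_deriv_space (hu : IsMildSolution f₀ u) {t : ℝ} (ht : 0 < t) (x : ℝ) :
    ContinuousAt (fun p : ℝ × ℝ => deriv (u p.1) p.2) (t, x) := by
  obtain ⟨U, U₁, U₂, C, -, hU, -, -, h⟩ := hu.exists_hasDerivAt_space_two (a := t / 4) (by positivity)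
  refine hU.continuousAt.congr ?_
  have hev : ∀ᶠ p : ℝ × ℝ in 𝓝 (t, x), 2 * (t / 4) < p.1 :=
    continuousAt_fst.eventually_const_lt (by simp only; linarith)
  filter_upwards [hev] with p hp using ((h p.1 hp.le p.2).2.1.deriv).symm

lemma continuousAt_deriv_space_two (hu : IsMildSolution f₀ u) {t : ℝ} (ht : 0 < t) (x : ℝ) :
    ContinuousAt (fun p : ℝ × ℝ => deriv (deriv (u p.1)) p.2) (t, x) := by
  obtain ⟨U, U₁, U₂, C, -, -, hU, -, h⟩ := hu.exists_hasDerivAt_space_two (a := t / 4) (by positivity)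
  refine hU.continuousAt.congr ?_
  have hev : ∀ᶠ p : ℝ × ℝ in 𝓝 (t, x), 2 * (t / 4) < p.1 :=
    continuousAt_fst.eventually_const_lt (by simp only; linarith)
  filter_upwards [hev] with p hp
  rw [funext fun y => (h p.1 hp.le y).2.1.deriv, (h p.1 hp.le p.2).2.2.deriv]

lemma exists_bound_deriv_two (hu : IsMildSolution f₀ u) {t : ℝ} (ht : 0 < t) :
    ∃ C, ∀ x, |deriv (deriv (u t)) x| ≤ C := by
  obtain ⟨U, U₁, U₂, C, -, -, hU, hb, h⟩ :=
    hu.exists_hasDerivAt_space_two (a := t / 2) (by positivity)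
  have h' := h t (by linarith)
  refine ⟨C, fun x => ?_⟩
  rw [funext fun y => (h' y).2.1.deriv, (h' x).2.2.deriv]
  exact hb _

end IsMildSolution

/-! ### The time derivative and the initial datum -/

lemma integrable_sq_gaussianReal (v : ℝ≥0) : Integrable (fun z : ℝ => z ^ 2) (gaussianReal 0 v) :=
  (memLp_id_gaussianReal 2).integrable_sq

lemma integral_sq_gaussianReal (v : ℝ≥0) : ∫ z, z ^ 2 ∂(gaussianReal 0 v) = v := by
  have := variance_fun_id_gaussianReal (μ := 0) (v := v)
  rw [variance_eq_integral (by fun_prop)] at this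
  simpa [integral_id_gaussianReal] using this

/-- Second-order Taylor formula with integral remainder. -/
lemma taylor_two_integral {f : ℝ → ℝ} (hf : ContDiff ℝ 2 f) (x y : ℝ) :
    f (x - y) = f x - y * deriv f x
      + y ^ 2 * ∫ θ in (0 : ℝ)..1, (1 - θ) * deriv (deriv f) (x - θ * y) := by
  have hf1 : ∀ z, HasDerivAt f (deriv f z) z := fun z => (hf.differentiable two_ne_zero z).hasDerivAt
  have hf2 : ∀ z, HasDerivAt (deriv f) (deriv (deriv f) z) z := fun z =>
    (hf.differentiable_deriv_two z).hasDerivAt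
  have hc : Continuous (deriv (deriv f)) := by
    have := hf.continuous_iteratedDeriv 2 le_rfl
    rwa [iteratedDeriv_succ, iteratedDeriv_one] at this
  have hd : ∀ θ : ℝ, HasDerivAt (fun θ : ℝ => f (x - θ * y) - (1 - θ) * y * deriv f (x - θ * y))
      (y ^ 2 * ((1 - θ) * deriv (deriv f) (x - θ * y))) θ := by
    intro θ
    have hl : HasDerivAt (fun θ : ℝ => x - θ * y) (-(1 * y)) θ :=
      ((hasDerivAt_id θ).mul_const y).const_sub x
    have h1 := (hf1 (x - θ * y)).comp θ hl
    have h2 := (hf2 (x - θ * y)).comp θ hl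
    have h3 : HasDerivAt (fun θ : ℝ => (1 - θ) * y) (-1 * y) θ :=
      ((hasDerivAt_id θ).const_sub 1).mul_const y
    refine (h1.sub (h3.mul h2)).congr_deriv ?_
    simp only [Function.comp]
    ring
  have := intervalIntegral.integral_eq_sub_of_hasDerivAt (a := 0) (b := 1) (fun θ _ => hd θ)
    (Continuous.intervalIntegrable (by fun_prop) _ _)
  rw [intervalIntegral.integral_const_mul] at this
  rw [this]
  simp

/-- The generator of the heat semigroup. -/
lemma tendsto_heatOp_sub_div {f : ℝ → ℝ} (hf : ContDiff ℝ 2 f) {C' : ℝ}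
    (hb : ∀ x, |deriv (deriv f) x| ≤ C') (x : ℝ) :
    Tendsto (fun h => (heatOp h f x - f x) / h) (𝓝[>] 0) (𝓝 (1 / 2 * deriv (deriv f) x)) := by
  have hc : Continuous (deriv (deriv f)) := by
    have := hf.continuous_iteratedDeriv 2 le_rfl
    rwa [iteratedDeriv_succ, iteratedDeriv_one] at this
  set ρ : ℝ → ℝ := fun y => ∫ θ in (0 : ℝ)..1, (1 - θ) * deriv (deriv f) (x - θ * y) with hρ
  have hρc : Continuous ρ :=
    intervalIntegral.continuous_parametric_intervalIntegral_of_continuous' (by fun_prop) 0 1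
  have hρ0 : ρ 0 = 1 / 2 * deriv (deriv f) x := by
    simp only [hρ, mul_zero, sub_zero]
    rw [intervalIntegral.integral_mul_const]
    rw [intervalIntegral.integral_sub (by simp) (by simp)]
    simp
    norm_num
  have hρb : ∀ y, |ρ y| ≤ C' := by
    intro y
    have := intervalIntegral.norm_integral_le_of_norm_le_const (a := (0 : ℝ)) (b := 1)
      (f := fun θ => (1 - θ) * deriv (deriv f) (x - θ * y)) (C := C') (fun θ hθ => by
        rw [uIoc_of_le zero_le_one] at hθ
        rw [norm_mul, Real.norm_eq_abs, Real.norm_eq_abs, abs_of_nonneg (sub_nonneg.2 hθ.2)]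
        have h1 := hb (x - θ * y)
        nlinarith [abs_nonneg (deriv (deriv f) (x - θ * y)), hθ.1])
    simpa using this
  have hfm : Measurable f := hf.continuous.measurable
  -- The linear Taylor term has mean zero, and the scaling `y = √h z` takes a factor `h` out of the
  -- quadratic remainder.
  have hrep : ∀ h : ℝ, 0 < h →
      (heatOp h f x - f x) / h = ∫ z, z ^ 2 * ρ (√h * z) ∂(gaussianReal 0 1) := by
    intro h hh
    have hi1 : Integrable (fun z : ℝ => √h * z * deriv f x) (gaussianReal 0 1) :=
      (((memLp_id_gaussianReal 1).integrable le_rfl).const_mul √h).mul_const _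
    have hi2 : Integrable (fun z : ℝ => z ^ 2 * ρ (√h * z)) (gaussianReal 0 1) :=
      integrable_mul_of_bounded (integrable_sq_gaussianReal 1) (by fun_prop) fun z => hρb _
    have e : ∀ z, f (x - √h * z) = f x - √h * z * deriv f x + h * (z ^ 2 * ρ (√h * z)) := by
      intro z
      rw [taylor_two_integral hf x (√h * z), mul_pow, Real.sq_sqrt hh.le, mul_assoc h]
    rw [heatOp_eq_integral_std hfm]
    simp_rw [e]
    have hi3 : Integrable (fun z : ℝ => f x - √h * z * deriv f x) (gaussianReal 0 1) :=
      (integrable_const _).sub hi1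
    rw [integral_add hi3 (hi2.const_mul h),
      integral_sub (integrable_const _) hi1, integral_const_mul, integral_mul_const,
      integral_const_mul, integral_id_gaussianReal, integral_const, probReal_univ, one_smul,
      mul_zero, zero_mul, sub_zero, add_sub_cancel_left, mul_div_cancel_left₀ _ hh.ne']
  have hlim : Tendsto (fun h : ℝ => ∫ z, z ^ 2 * ρ (√h * z) ∂(gaussianReal 0 1)) (𝓝[>] 0)
      (𝓝 (∫ z, z ^ 2 * ρ 0 ∂(gaussianReal 0 1))) := by
    refine tendsto_integral_filter_of_dominated_convergence (fun z => z ^ 2 * C') ?_ ?_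
      ((integrable_sq_gaussianReal 1).mul_const C') ?_
    · exact Eventually.of_forall fun h => Measurable.aestronglyMeasurable (by fun_prop)
    · refine Eventually.of_forall fun h => ae_of_all _ fun z => ?_
      rw [norm_mul, Real.norm_eq_abs, Real.norm_eq_abs, abs_of_nonneg (sq_nonneg z)]
      exact mul_le_mul_of_nonneg_left (hρb _) (sq_nonneg z)
    · refine ae_of_all _ fun z => ?_
      have : Continuous fun h : ℝ => z ^ 2 * ρ (√h * z) := by fun_prop
      simpa using (this.tendsto 0).mono_left nhdsWithin_le_nhds
  rw [integral_mul_const, integral_sq_gaussianReal, hρ0, NNReal.coe_one, one_mul] at hlim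
  refine hlim.congr' ?_
  filter_upwards [self_mem_nhdsWithin] with h hh using (hrep h hh).symm

namespace IsMildSolution

variable {f₀ : ℝ → ℝ} {u : ℝ → ℝ → ℝ}

lemma continuousAt_source (hu : IsMildSolution f₀ u) {t : ℝ} (ht : 0 < t) (x : ℝ) :
    ContinuousAt (fun p : ℝ × ℝ => Real.exp (-p.1) * heatOp p.1 (fun y => u p.2 y ^ 2) x) (0, t) := by
  refine ContinuousAt.mul (by fun_prop) ?_
  have e : ∀ p : ℝ × ℝ, heatOp p.1 (fun y => u p.2 y ^ 2) x
      = ∫ z, u p.2 (x - √p.1 * z) ^ 2 ∂(gaussianReal 0 1) := fun p =>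
    heatOp_eq_integral_std ((hu.measurable_slice p.2).pow_const 2) p.1 x
  simp_rw [e]
  refine continuousAt_of_dominated (bound := fun _ => 1) ?_ ?_ (integrable_const _) ?_
  · exact Eventually.of_forall fun p => Measurable.aestronglyMeasurable
      (((hu.measurable_slice p.2).pow_const 2).comp
        (by fun_prop : Measurable fun z : ℝ => x - √p.1 * z))
  · exact Eventually.of_forall fun p => ae_of_all _ fun z => hu.bound_sq _ _
  · refine ae_of_all _ fun z => ContinuousAt.pow ?_ 2
    have h1 : ContinuousAt (fun p : ℝ × ℝ => (p.2, x - √p.1 * z)) (0, t) := by fun_prop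
    refine ContinuousAt.comp (g := fun p : ℝ × ℝ => u p.1 p.2) ?_ h1
    simpa using hu.continuousAt_uncurry ht x

lemma tendsto_source_div (hu : IsMildSolution f₀ u) {t : ℝ} (ht : 0 < t) (x : ℝ) :
    Tendsto (fun h => (∫ r in t..t + h,
      Real.exp (-(t + h - r)) * heatOp (t + h - r) (fun y => u r y ^ 2) x) / h)
      (𝓝[>] 0) (𝓝 (u t x ^ 2)) := by
  rw [Metric.tendsto_nhdsWithin_nhds]
  intro ε hε
  have hc := hu.continuousAt_source ht x
  rw [Metric.continuousAt_iff] at hc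
  obtain ⟨δ, hδ, hball⟩ := hc (ε / 2) (by positivity)
  refine ⟨δ, hδ, fun h hh hhδ => ?_⟩
  have hh0 : 0 < h := hh
  rw [Real.dist_eq, sub_zero, abs_of_pos hh0] at hhδ
  have hint := intervalIntegrable_source (q := fun s y => u s y ^ 2) hu.measurable_sq hu.bound_sq
    (a := t) (b := t + h) (t := t + h) (by linarith) le_rfl x
  have h1 := intervalIntegral.norm_integral_le_of_norm_le_const (a := t) (b := t + h)
    (f := fun r => Real.exp (-(t + h - r)) * heatOp (t + h - r) (fun y => u r y ^ 2) x - u t x ^ 2)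
    (C := ε / 2) (fun r hr => by
      rw [uIoc_of_le (by linarith)] at hr
      have := hball (x := (t + h - r, r)) (by
        rw [Prod.dist_eq, max_lt_iff, Real.dist_eq, Real.dist_eq, sub_zero, abs_lt, abs_lt]
        exact ⟨⟨by linarith [hr.2], by linarith [hr.1]⟩, by linarith [hr.1], by linarith [hr.2]⟩)
      simp only [Real.dist_eq, neg_zero, Real.exp_zero, one_mul, heatOp_zero] at this
      exact this.le)
  rw [intervalIntegral.integral_sub hint (by simp), intervalIntegral.integral_const,
    add_sub_cancel_left, smul_eq_mul, abs_of_pos hh0, Real.norm_eq_abs] at h1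
  rw [Real.dist_eq, div_sub' hh0.ne', abs_div, abs_of_pos hh0, div_lt_iff₀ hh0]
  nlinarith

/-- Restarting at `t` splits the difference quotient into three: the generator of the heat semigroup
applied to `u t`, the derivative `-1` of the damping, and the mean of the source over a short
interval. Restarting only looks forward, hence the one-sided derivative. -/
lemma hasDerivWithinAt_time (hu : IsMildSolution f₀ u) {t : ℝ} (ht : 0 < t) (x : ℝ) :
    HasDerivWithinAt (fun s => u s x)
      (1 / 2 * deriv (deriv (u t)) x + u t x ^ 2 - u t x) (Ici t) t := by
  obtain ⟨C, hC⟩ := hu.exists_bound_deriv_two ht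
  have h1 := tendsto_heatOp_sub_div (hu.contDiff_space ht) hC x
  have h2 := hu.tendsto_source_div ht x
  have h3 : Tendsto (fun h : ℝ => (Real.exp (-h) - 1) / h) (𝓝[>] 0) (𝓝 (-1)) := by
    have hd : HasDerivAt (fun h : ℝ => Real.exp (-h)) (-1) 0 := by
      simpa using (hasDerivAt_id (0 : ℝ)).neg.exp
    have := (hasDerivAt_iff_tendsto_slope.1 hd).mono_left
      (nhdsWithin_mono _ (fun y (hy : y ∈ Ioi 0) => ne_of_gt hy))
    refine this.congr fun h => ?_
    simp [slope_def_field]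
  have h4 : Tendsto (fun h : ℝ => Real.exp (-h)) (𝓝[>] 0) (𝓝 1) := by
    have : Continuous fun h : ℝ => Real.exp (-h) := by fun_prop
    simpa using (this.tendsto 0).mono_left nhdsWithin_le_nhds
  have hlim := ((h4.mul h1).add (h3.mul_const (u t x))).add h2
  refine hasDerivWithinAt_Ioi_iff_Ici.1
    ((hasDerivWithinAt_iff_tendsto_slope' self_notMem_Ioi).2 ?_)
  have hshift : Tendsto (fun s : ℝ => s - t) (𝓝[>] t) (𝓝[>] 0) := by
    refine tendsto_nhdsWithin_iff.2 ⟨?_, ?_⟩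
    · have : Continuous fun s : ℝ => s - t := by fun_prop
      simpa using (this.tendsto t).mono_left nhdsWithin_le_nhds
    · filter_upwards [self_mem_nhdsWithin] with s hs using sub_pos.2 (mem_Ioi.1 hs)
  have hlim' := hlim.comp hshift
  rw [show 1 * (1 / 2 * deriv (deriv (u t)) x) + -1 * u t x + u t x ^ 2
    = 1 / 2 * deriv (deriv (u t)) x + u t x ^ 2 - u t x by ring] at hlim'
  refine hlim'.congr' ?_
  filter_upwards [self_mem_nhdsWithin] with s hs
  have hst : 0 < s - t := sub_pos.2 (mem_Ioi.1 hs)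
  simp only [Function.comp, slope_def_field]
  rw [hu.restart ht.le (mem_Ioi.1 hs).le x, add_sub_cancel]
  field_simp
  ring

/-- The right derivative `g` is continuous in time, so `u` coincides with a primitive of `g`: two
continuous functions with the same right derivative and the same starting value are equal. -/
lemma hasDerivAt_time (hu : IsMildSolution f₀ u) {t : ℝ} (ht : 0 < t) (x : ℝ) :
    HasDerivAt (fun s => u s x)
      (1 / 2 * deriv (deriv (u t)) x + u t x ^ 2 - u t x) t := by
  set g : ℝ → ℝ := fun s => 1 / 2 * deriv (deriv (u s)) x + u s x ^ 2 - u s x with hg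
  have hx : ∀ s : ℝ, ContinuousAt (fun s : ℝ => (s, x)) s := fun s => by fun_prop
  have huc : ∀ s, 0 < s → ContinuousAt (fun s => u s x) s := fun s hs =>
    ContinuousAt.comp (g := fun p : ℝ × ℝ => u p.1 p.2) (f := fun s : ℝ => (s, x)) (x := s)
      (hu.continuousAt_uncurry hs x) (hx s)
  have hgc : ∀ s, 0 < s → ContinuousAt g s := fun s hs =>
    (((ContinuousAt.comp (g := fun p : ℝ × ℝ => deriv (deriv (u p.1)) p.2) (f := fun s : ℝ => (s, x))
      (x := s)
      (hu.continuousAt_deriv_space_two hs x) (hx s)).const_mul _).add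
      ((huc s hs).pow 2)).sub (huc s hs)
  have hgcont : ContinuousOn g (Ioi 0) := fun s hs => (hgc s hs).continuousWithinAt
  have hprim : ∀ s, 0 < s → HasDerivAt (fun s => u (t / 2) x + ∫ r in t / 2..s, g r) (g s) s := by
    intro s hs
    refine (intervalIntegral.integral_hasDerivAt_right ?_ ?_ (hgc s hs)).const_add _
    · refine (hgcont.mono fun r hr => ?_).intervalIntegrable
      exact (lt_min (half_pos ht) hs).trans_le hr.1
    · exact hgcont.stronglyMeasurableAtFilter isOpen_Ioi s hs
  have heq : ∀ s ∈ Icc (t / 2) (2 * t), u s x = u (t / 2) x + ∫ r in t / 2..s, g r := by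
    refine eq_of_has_deriv_right_eq (f' := g) (fun s hs => ?_) (fun s hs => ?_) ?_ ?_ (by simp)
    · exact hu.hasDerivWithinAt_time ((half_pos ht).trans_le hs.1) x
    · exact (hprim s ((half_pos ht).trans_le hs.1)).hasDerivWithinAt
    · exact fun s hs => (huc s ((half_pos ht).trans_le hs.1)).continuousWithinAt
    · exact fun s hs => (hprim s ((half_pos ht).trans_le hs.1)).continuousAt.continuousWithinAt
  refine (hprim t ht).congr_of_eventuallyEq ?_
  filter_upwards [Icc_mem_nhds (show t / 2 < t by linarith) (show t < 2 * t by linarith)] with s hs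
  exact heq s hs

/-- A mild solution attains the initial datum at its continuity points. -/
lemma continuousWithinAt_initial (hu : IsMildSolution f₀ u) {x : ℝ} (hx : ContinuousAt f₀ x) :
    ContinuousWithinAt (fun p : ℝ × ℝ => u p.1 p.2) {p | 0 ≤ p.1} (0, x) := by
  have hheat : ContinuousAt (fun p : ℝ × ℝ => heatOp p.1 f₀ p.2) (0, x) := by
    have e : ∀ p : ℝ × ℝ, heatOp p.1 f₀ p.2
        = ∫ z, f₀ (p.2 - √p.1 * z) ∂(gaussianReal 0 1) := fun p =>
      heatOp_eq_integral_std hu.measurable_initial p.1 p.2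
    simp_rw [e]
    refine continuousAt_of_dominated (bound := fun _ => 1) ?_ ?_ (integrable_const _) ?_
    · exact Eventually.of_forall fun p => Measurable.aestronglyMeasurable
        (hu.measurable_initial.comp (by fun_prop : Measurable fun z : ℝ => p.2 - √p.1 * z))
    · exact Eventually.of_forall fun p => ae_of_all _ fun z => hu.bound_initial _
    · refine ae_of_all _ fun z => ?_
      have h1 : ContinuousAt (fun p : ℝ × ℝ => p.2 - √p.1 * z) (0, x) := by fun_prop
      refine ContinuousAt.comp (g := f₀) ?_ h1
      simpa using hx
  -- The integrand is bounded by `1`, so the Duhamel integral is at most the elapsed time.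
  have hsrc : Tendsto (fun p : ℝ × ℝ => ∫ s in 0..p.1,
      Real.exp (-(p.1 - s)) * heatOp (p.1 - s) (fun y => u s y ^ 2) p.2)
      (𝓝[{p | 0 ≤ p.1}] (0, x)) (𝓝 0) := by
    have hlim : Tendsto (fun p : ℝ × ℝ => 1 * |p.1 - 0|) (𝓝[{p | 0 ≤ p.1}] (0, x)) (𝓝 0) := by
      have : Continuous fun p : ℝ × ℝ => 1 * |p.1 - 0| := by fun_prop
      simpa using (this.tendsto (0, x)).mono_left nhdsWithin_le_nhds
    refine squeeze_zero_norm' ?_ hlim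
    filter_upwards [self_mem_nhdsWithin] with p hp
    refine intervalIntegral.norm_integral_le_of_norm_le_const fun s hs => ?_
    rw [uIoc_of_le hp] at hs
    exact abs_source_le (q := fun s y => u s y ^ 2) hu.bound_sq hs.2 p.2
  have hfirst : Tendsto (fun p : ℝ × ℝ => Real.exp (-p.1) * heatOp p.1 f₀ p.2)
      (𝓝[{p | 0 ≤ p.1}] (0, x)) (𝓝 (f₀ x)) := by
    have : ContinuousAt (fun p : ℝ × ℝ => Real.exp (-p.1) * heatOp p.1 f₀ p.2) (0, x) :=
      ContinuousAt.mul (by fun_prop) hheat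
    simpa [heatOp_zero] using this.tendsto.mono_left nhdsWithin_le_nhds
  have h0 : u 0 x = f₀ x := by simp [hu.equation 0 le_rfl x, heatOp_zero]
  rw [ContinuousWithinAt, h0, ← add_zero (f₀ x)]
  refine (hfirst.add hsrc).congr' ?_
  filter_upwards [self_mem_nhdsWithin] with p hp using (hu.equation p.1 hp p.2).symm

end IsMildSolution

end BBM

/-! ### The logistic equation for the generating function -/

lemma reactionRate_den_pos {σ : ℝ} (h0 : 0 ≤ σ) (h1 : σ ≤ 1) (t : ℝ) :
    0 < (1 - σ) * Real.exp t + σ := by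
  rcases h0.eq_or_lt with rfl | h
  · simpa using Real.exp_pos t
  · have := mul_nonneg (sub_nonneg.2 h1) (Real.exp_nonneg t)
    linarith

lemma reactionRate_nonneg {σ : ℝ} (h0 : 0 ≤ σ) (h1 : σ ≤ 1) (t : ℝ) : 0 ≤ reactionRate σ t :=
  div_nonneg h0 (reactionRate_den_pos h0 h1 t).le

lemma reactionRate_le_one {σ : ℝ} (h0 : 0 ≤ σ) (h1 : σ ≤ 1) (t : ℝ) : reactionRate σ t ≤ 1 := by
  rw [reactionRate, div_le_one (reactionRate_den_pos h0 h1 t)]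
  have := mul_nonneg (sub_nonneg.2 h1) (Real.exp_nonneg t)
  linarith

lemma reactionRate_pos {σ : ℝ} (h0 : 0 < σ) (h1 : σ ≤ 1) (t : ℝ) : 0 < reactionRate σ t :=
  div_pos h0 (reactionRate_den_pos h0.le h1 t)

/-- The reaction rate obeys the equation of `E[σ^n(t)]`, which is what identifies the two. -/
lemma hasDerivAt_reactionRate {σ : ℝ} (h0 : 0 ≤ σ) (h1 : σ ≤ 1) (t : ℝ) :
    HasDerivAt (reactionRate σ) (reactionRate σ t ^ 2 - reactionRate σ t) t := by
  have hne := (reactionRate_den_pos h0 h1 t).ne'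
  have hd : HasDerivAt (fun t => (1 - σ) * Real.exp t + σ) ((1 - σ) * Real.exp t) t :=
    ((Real.hasDerivAt_exp t).const_mul (1 - σ)).add_const σ
  refine ((hasDerivAt_const t σ).fun_div hd hne).congr_deriv ?_
  rw [reactionRate]
  field_simp
  ring

namespace BBM

/-- A spatially constant mild solution solves the logistic equation. -/
lemma IsMildSolution.eq_reactionRate {σ : ℝ} {u : ℝ → ℝ → ℝ} (h0 : 0 ≤ σ) (h1 : σ ≤ 1)
    (hu : IsMildSolution (fun _ => σ) u) (hconst : ∀ t x y, u t x = u t y) {t : ℝ} (ht : 0 ≤ t)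
    (x : ℝ) : u t x = reactionRate σ t := by
  -- The weight `exp (-2s)` turns the factor `u + v - 1` in the derivative of `(u - v)²` into `u + v
  -- - 2`, which is nonpositive as `u, v ≤ 1`. So `D` is antitone, starts at zero and is
  -- nonnegative.
  set D : ℝ → ℝ := fun s => (u s x - reactionRate σ s) ^ 2 * Real.exp (-(2 * s)) with hD
  have hud : ∀ s, 0 < s → HasDerivAt (fun s => u s x) (u s x ^ 2 - u s x) s := by
    intro s hs
    have h := hu.hasDerivAt_time hs x
    have e1 : u s = fun _ => u s x := funext fun y => hconst s y x
    have e2 : deriv (u s) = fun _ => 0 := by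
      rw [e1]
      simp
    rw [e2] at h
    simpa using h
  have hDd : ∀ s, 0 < s → HasDerivAt D (2 * (u s x - reactionRate σ s) ^ 2
      * (u s x + reactionRate σ s - 2) * Real.exp (-(2 * s))) s := by
    intro s hs
    have he : HasDerivAt (fun s => Real.exp (-(2 * s))) (Real.exp (-(2 * s)) * (-2)) s := by
      simpa using ((hasDerivAt_id s).const_mul 2).neg.exp
    refine ((((hud s hs).fun_sub (hasDerivAt_reactionRate h0 h1 s)).fun_pow 2).fun_mul he).congr_deriv ?_
    simp
    ring
  have hcont : ContinuousOn D (Icc 0 t) := by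
    intro s hs
    rcases hs.1.eq_or_lt with rfl | hs0
    · have hc := hu.continuousWithinAt_initial (x := x) continuousAt_const
      have hc' : ContinuousWithinAt (fun s => u s x) (Icc 0 t) 0 :=
        ContinuousWithinAt.comp (g := fun p : ℝ × ℝ => u p.1 p.2) (f := fun s : ℝ => (s, x)) hc
          (by fun_prop) fun s hs => hs.1
      exact ((hc'.sub (hasDerivAt_reactionRate h0 h1 0).continuousAt.continuousWithinAt).pow 2).mul
        (by fun_prop)
    · exact (hDd s hs0).continuousAt.continuousWithinAt
  have hanti : AntitoneOn D (Icc 0 t) := by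
    refine antitoneOn_of_hasDerivWithinAt_nonpos (convex_Icc 0 t) hcont
      (fun s hs => ((hDd s ?_).hasDerivWithinAt)) fun s hs => ?_
    · rw [interior_Icc] at hs
      exact hs.1
    · have e1 := (abs_le.1 (hu.bound s x)).2
      have e2 := reactionRate_le_one h0 h1 s
      refine mul_nonpos_of_nonpos_of_nonneg (mul_nonpos_of_nonneg_of_nonpos (by positivity) ?_)
        (Real.exp_nonneg _)
      linarith
  have hle := hanti (left_mem_Icc.2 ht) (right_mem_Icc.2 ht) ht
  have hD0 : D 0 = 0 := by
    have : u 0 x = σ := by simp [hu.equation 0 le_rfl x, heatOp_zero]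
    simp [hD, this, reactionRate]
  rw [hD0] at hle
  have hsq : (u t x - reactionRate σ t) ^ 2 = 0 :=
    le_antisymm (nonpos_of_mul_nonpos_left hle (Real.exp_pos _)) (sq_nonneg _)
  exact sub_eq_zero.1 (pow_eq_zero_iff two_ne_zero |>.1 hsq)

end BBM

/-! ### The canonical space of lifetimes and paths, and its branching structure -/

section Infinite

variable {ι κ₁ κ₂ : Type*} {X : ι → Type*} [∀ i, MeasurableSpace (X i)]

lemma comap_reindex_le (f : κ₁ → ι) :
    MeasurableSpace.comap (fun (ω : ∀ i, X i) k => ω (f k)) MeasurableSpace.pi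
      ≤ ⨆ i ∈ range f, MeasurableSpace.comap (fun ω : ∀ i, X i => ω i) inferInstance := by
  rw [MeasurableSpace.pi, MeasurableSpace.comap_iSup]
  refine iSup_le fun k => ?_
  rw [MeasurableSpace.comap_comp]
  exact le_iSup₂_of_le (f k) (mem_range_self k) le_rfl

lemma indepFun_infinitePi_of_disjoint (μ : ∀ i, Measure (X i)) [∀ i, IsProbabilityMeasure (μ i)]
    (f : κ₁ → ι) (g : κ₂ → ι) (hfg : Disjoint (range f) (range g)) :
    IndepFun (fun (ω : ∀ i, X i) k => ω (f k)) (fun (ω : ∀ i, X i) k => ω (g k))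
      (Measure.infinitePi μ) := by
  have h : iIndepFun (fun i (ω : ∀ i, X i) => ω i) (Measure.infinitePi μ) :=
    iIndepFun_infinitePi (X := fun _ x => x) fun i => measurable_id
  have hle : ∀ i, MeasurableSpace.comap (fun ω : ∀ i, X i => ω i) inferInstance
      ≤ MeasurableSpace.pi := fun i => (measurable_pi_apply i).comap_le
  have := indep_iSup_of_disjoint hle h hfg
  rw [IndepFun_iff_Indep]
  exact indep_of_indep_of_le_right (indep_of_indep_of_le_left this (comap_reindex_le f))
    (comap_reindex_le g)

end Infinite

namespace BBM

/-- Path evaluation that is jointly measurable and agrees with evaluation on continuous paths. -/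
noncomputable def evalPath (b : ℝ≥0 → ℝ) (s : ℝ≥0) : ℝ :=
  limsup (fun n : ℕ => b (⌊(s : ℝ) * n⌋₊ / (n : ℝ)).toNNReal) atTop

/-- Evaluation at a random time is not jointly measurable on the full product space. Each
approximant reads the path at countably many deterministic times only, so it is measurable, and so
is the limsup. -/
lemma measurable_evalPath : Measurable fun p : (ℝ≥0 → ℝ) × ℝ≥0 => evalPath p.1 p.2 := by
  refine Measurable.limsup fun n => ?_
  have h1 : Measurable fun q : (ℝ≥0 → ℝ) × ℕ => q.1 ((q.2 : ℝ) / (n : ℝ)).toNNReal :=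
    measurable_from_prod_countable_left fun k =>
      (measurable_pi_apply ((k : ℝ) / (n : ℝ)).toNNReal : Measurable fun b : ℝ≥0 → ℝ => _)
  exact h1.comp (measurable_fst.prodMk (Nat.measurable_floor.comp
    (by fun_prop : Measurable fun p : (ℝ≥0 → ℝ) × ℝ≥0 => (p.2 : ℝ) * n)))

lemma _root_.Measurable.evalPath {α : Type*} [MeasurableSpace α] {b : α → ℝ≥0 → ℝ} {s : α → ℝ≥0}
    (hb : Measurable b) (hs : Measurable s) : Measurable fun a => evalPath (b a) (s a) := by
  have h := measurable_evalPath.comp (hb.prodMk hs)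
  exact h

lemma evalPath_of_continuous {b : ℝ≥0 → ℝ} (hb : Continuous b) (s : ℝ≥0) : evalPath b s = b s := by
  have h1 : Tendsto (fun n : ℕ => (⌊(s : ℝ) * n⌋₊ / (n : ℝ))) atTop (𝓝 (s : ℝ)) :=
    (tendsto_nat_floor_mul_div_atTop (R := ℝ) s.coe_nonneg).comp tendsto_natCast_atTop_atTop
  have h2 : Tendsto (fun n : ℕ => b (⌊(s : ℝ) * n⌋₊ / (n : ℝ)).toNNReal) atTop (𝓝 (b s)) := by
    have h3 := (continuous_real_toNNReal.tendsto (s : ℝ)).comp h1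
    rw [Real.toNNReal_coe] at h3
    exact (hb.tendsto s).comp h3
  exact h2.limsup_eq

attribute [irreducible] evalPath

/-- The canonical space of lifetimes and displacement paths. -/
abbrev Tree : Type := List Bool → ℝ × (ℝ≥0 → ℝ)

namespace Tree

/-- Lifetimes on the canonical space. -/
def lifetime (u : List Bool) (τ : Tree) : ℝ := (τ u).1

/-- Displacements on the canonical space. -/
noncomputable def displacement (u : List Bool) (s : ℝ≥0) (τ : Tree) : ℝ := evalPath (τ u).2 s

/-- The subtree of descendants of the child `b` of the initial particle. -/
def child (b : Bool) (τ : Tree) : Tree := fun u => τ (u ++ [b])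

lemma measurable_child (b : Bool) : Measurable (child b) :=
  measurable_pi_lambda _ fun _ => measurable_pi_apply _

lemma measurable_displacement {α : Type*} [MeasurableSpace α] {u : List Bool} {s : α → ℝ≥0}
    {τ : α → Tree} (hs : Measurable s) (hτ : Measurable τ) :
    Measurable fun a => displacement u (s a) (τ a) := by
  have h1 : Measurable fun a => (τ a u).2 := measurable_snd.comp (measurable_pi_iff.1 hτ u)
  exact h1.evalPath hs

lemma measurable_lifetime (u : List Bool) : Measurable (lifetime u) :=
  measurable_fst.comp (measurable_pi_apply u)

lemma measurable_birthTime : ∀ u, Measurable (birthTime lifetime u)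
  | [] => measurable_const
  | _ :: u => (measurable_birthTime u).add (measurable_lifetime u)

lemma measurable_birthPlace : ∀ u, Measurable (birthPlace lifetime displacement u)
  | [] => measurable_const
  | _ :: u => (measurable_birthPlace u).add
      (measurable_displacement (measurable_lifetime u).real_toNNReal measurable_id)

lemma measurable_position (u : List Bool) :
    Measurable fun p : ℝ × Tree => position lifetime displacement u p.1 p.2 :=
  ((measurable_birthPlace u).comp measurable_snd).add (measurable_displacement
    (measurable_fst.sub ((measurable_birthTime u).comp measurable_snd)).real_toNNReal measurable_snd)

lemma measurableSet_alive (u : List Bool) :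
    MeasurableSet {p : ℝ × Tree | u ∈ alive lifetime p.1 p.2} :=
  (measurableSet_le ((measurable_birthTime u).comp measurable_snd) measurable_fst).inter
    (measurableSet_lt measurable_fst (((measurable_birthTime u).comp measurable_snd).add
      ((measurable_lifetime u).comp measurable_snd)))

/-- New letters are added at the head of a word, so its last letter records the first split.
Decomposing at the root therefore peels letters off the end, against the direction of the recursion.
-/
lemma birthTime_append (b : Bool) (τ : Tree) : ∀ u : List Bool,
    birthTime lifetime (u ++ [b]) τ = lifetime [] τ + birthTime lifetime u (child b τ)
  | [] => by simp [birthTime]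
  | _ :: u => by
    rw [List.cons_append, birthTime, birthTime, birthTime_append b τ u, add_assoc]
    rfl

lemma birthPlace_append (b : Bool) (τ : Tree) : ∀ u : List Bool,
    birthPlace lifetime displacement (u ++ [b]) τ = displacement [] (lifetime [] τ).toNNReal τ
      + birthPlace lifetime displacement u (child b τ)
  | [] => by simp [birthPlace]
  | _ :: u => by
    rw [List.cons_append, birthPlace, birthPlace, birthPlace_append b τ u, add_assoc]
    rfl

lemma position_append (b : Bool) (τ : Tree) (u : List Bool) (t : ℝ) :
    position lifetime displacement (u ++ [b]) t τ = displacement [] (lifetime [] τ).toNNReal τ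
      + position lifetime displacement u (t - lifetime [] τ) (child b τ) := by
  rw [position, position, birthPlace_append, birthTime_append, add_assoc, sub_sub]
  rfl

lemma append_mem_alive (b : Bool) (τ : Tree) (u : List Bool) (t : ℝ) :
    u ++ [b] ∈ alive lifetime t τ ↔ u ∈ alive lifetime (t - lifetime [] τ) (child b τ) := by
  have h : lifetime (u ++ [b]) τ = lifetime u (child b τ) := rfl
  simp only [alive, mem_ofPred_eq, birthTime_append, h]
  constructor <;> rintro ⟨h1, h2⟩ <;> constructor <;> linarith

lemma birthTime_nonneg {τ : Tree} (hτ : ∀ u, 0 ≤ lifetime u τ) :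
    ∀ u, 0 ≤ birthTime lifetime u τ
  | [] => le_rfl
  | _ :: u => add_nonneg (birthTime_nonneg hτ u) (hτ u)

lemma alive_of_lt {τ : Tree} (hτ : ∀ u, 0 ≤ lifetime u τ) {t : ℝ} (ht : 0 ≤ t)
    (h : t < lifetime [] τ) : alive lifetime t τ = {[]} := by
  ext u
  rw [mem_singleton_iff]
  constructor
  · intro hu
    rcases List.eq_nil_or_concat' u with rfl | ⟨v, b, rfl⟩
    · rfl
    · have h1 := hu.1
      rw [birthTime_append] at h1
      have h2 := birthTime_nonneg (τ := child b τ) (fun u => hτ (u ++ [b])) v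
      linarith
  · rintro rfl
    exact ⟨ht, by simpa [birthTime] using h⟩

lemma alive_of_le {τ : Tree} {t : ℝ} (h : lifetime [] τ ≤ t) :
    alive lifetime t τ
      = (fun u => u ++ [false]) '' alive lifetime (t - lifetime [] τ) (child false τ)
        ∪ (fun u => u ++ [true]) '' alive lifetime (t - lifetime [] τ) (child true τ) := by
  ext u
  rcases List.eq_nil_or_concat' u with rfl | ⟨v, b, rfl⟩
  · simp only [mem_union, mem_image, List.append_eq_nil_iff, List.cons_ne_self,
      and_false, exists_false, or_false, iff_false]
    rintro ⟨-, h2⟩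
    simp only [birthTime, zero_add] at h2
    linarith
  · rw [append_mem_alive]
    cases b <;> simp

end Tree

/-! ### The branching functional and its mild equation -/

open Classical in
/-- `σ ^ n(t)` on the event that there are finitely many particles, and that `x` minus the position
of any of them belongs to `S`. -/
noncomputable def branchFunctional (σ : ℝ) (S : Set ℝ) (t x : ℝ) (τ : Tree) : ℝ :=
  if (alive Tree.lifetime t τ).Finite ∧
      ∀ u ∈ alive Tree.lifetime t τ, x - position Tree.lifetime Tree.displacement u t τ ∈ S
  then σ ^ (alive Tree.lifetime t τ).ncard else 0

lemma measurable_branchFunctional (σ : ℝ) {S : Set ℝ} (hS : MeasurableSet S) :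
    Measurable fun p : ℝ × ℝ × Tree => branchFunctional σ S p.1 p.2.1 p.2.2 := by
  have ha : ∀ u, MeasurableSet {p : ℝ × ℝ × Tree | u ∈ alive Tree.lifetime p.1 p.2.2} := fun u =>
    (by fun_prop : Measurable fun p : ℝ × ℝ × Tree => (p.1, p.2.2)) (Tree.measurableSet_alive u)
  have hm : Measurable fun p : ℝ × ℝ × Tree => alive Tree.lifetime p.1 p.2.2 :=
    measurable_set_iff.2 fun u => measurable_mem.2 (ha u)
  -- The label set is countable, so its finite subsets form a countable and hence measurable family.
  refine Measurable.ite ((hm Countable.ofPred_finite.measurableSet).inter ?_) ?_ measurable_const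
  · have : {p : ℝ × ℝ × Tree | ∀ u ∈ alive Tree.lifetime p.1 p.2.2,
        p.2.1 - position Tree.lifetime Tree.displacement u p.1 p.2.2 ∈ S}
        = ⋂ u, ({p : ℝ × ℝ × Tree | u ∈ alive Tree.lifetime p.1 p.2.2}ᶜ ∪
          {p | p.2.1 - position Tree.lifetime Tree.displacement u p.1 p.2.2 ∈ S}) := by
      ext p
      simp [imp_iff_not_or]
    change MeasurableSet {p : ℝ × ℝ × Tree | ∀ u ∈ alive Tree.lifetime p.1 p.2.2,
        p.2.1 - position Tree.lifetime Tree.displacement u p.1 p.2.2 ∈ S}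
    rw [this]
    refine MeasurableSet.iInter fun u => (ha u).compl.union ?_
    exact ((by fun_prop : Measurable fun p : ℝ × ℝ × Tree => p.2.1).sub
      ((Tree.measurable_position u).comp
        (by fun_prop : Measurable fun p : ℝ × ℝ × Tree => (p.1, p.2.2)))) hS
  · exact (measurable_from_nat (f := fun n => σ ^ n)).comp (measurable_ncard.comp hm)

lemma abs_branchFunctional_le {σ : ℝ} (h0 : 0 ≤ σ) (h1 : σ ≤ 1) (S : Set ℝ) (t x : ℝ) (τ : Tree) :
    |branchFunctional σ S t x τ| ≤ 1 := by
  unfold branchFunctional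
  split_ifs
  · rw [abs_of_nonneg (pow_nonneg h0 _)]
    exact pow_le_one₀ h0 h1
  · simp

lemma branchFunctional_of_lt (σ : ℝ) (S : Set ℝ) {τ : Tree} (hτ : ∀ u, 0 ≤ Tree.lifetime u τ)
    {t : ℝ} (ht : 0 ≤ t) (h : t < Tree.lifetime [] τ) (x : ℝ) :
    branchFunctional σ S t x τ
      = S.indicator (fun _ => σ) (x - Tree.displacement [] t.toNNReal τ) := by
  classical
  rw [branchFunctional, Tree.alive_of_lt hτ ht h]
  simp [position, birthPlace, birthTime, indicator_apply]

/-- This is the branching property path by path: particle numbers add, so powers of `σ` multiply,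
and the constraint splits over the two subtrees. The finiteness clause keeps this valid when a
subtree is infinite, where `ncard` would be `0`. -/
lemma branchFunctional_of_le (σ : ℝ) (S : Set ℝ) {τ : Tree} {t : ℝ}
    (h : Tree.lifetime [] τ ≤ t) (x : ℝ) :
    branchFunctional σ S t x τ
      = branchFunctional σ S (t - Tree.lifetime [] τ)
          (x - Tree.displacement [] (Tree.lifetime [] τ).toNNReal τ) (Tree.child false τ)
        * branchFunctional σ S (t - Tree.lifetime [] τ)
          (x - Tree.displacement [] (Tree.lifetime [] τ).toNNReal τ) (Tree.child true τ) := by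
  classical
  set d := Tree.displacement [] (Tree.lifetime [] τ).toNNReal τ
  set s := t - Tree.lifetime [] τ
  have hinj : ∀ b : Bool, Function.Injective fun u : List Bool => u ++ [b] := fun b =>
    List.append_left_injective [b]
  have hdisj : Disjoint
      ((fun u => u ++ [false]) '' alive Tree.lifetime s (Tree.child false τ))
      ((fun u => u ++ [true]) '' alive Tree.lifetime s (Tree.child true τ)) := by
    rw [Set.disjoint_left]
    rintro _ ⟨u, -, rfl⟩ ⟨v, -, hv⟩
    simp at hv
  have hfin : (alive Tree.lifetime t τ).Finite ↔
      (alive Tree.lifetime s (Tree.child false τ)).Finite ∧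
        (alive Tree.lifetime s (Tree.child true τ)).Finite := by
    rw [Tree.alive_of_le h, finite_union, finite_image_iff (hinj _).injOn,
      finite_image_iff (hinj _).injOn]
  have hall : (∀ u ∈ alive Tree.lifetime t τ,
      x - position Tree.lifetime Tree.displacement u t τ ∈ S) ↔
      (∀ u ∈ alive Tree.lifetime s (Tree.child false τ),
        x - d - position Tree.lifetime Tree.displacement u s (Tree.child false τ) ∈ S) ∧
      (∀ u ∈ alive Tree.lifetime s (Tree.child true τ),
        x - d - position Tree.lifetime Tree.displacement u s (Tree.child true τ) ∈ S) := by
    rw [Tree.alive_of_le h]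
    simp only [mem_union, or_imp, forall_and, forall_mem_image, Tree.position_append, sub_sub]
    rfl
  simp only [branchFunctional, hfin, hall]
  by_cases hf : (alive Tree.lifetime s (Tree.child false τ)).Finite ∧
      ∀ u ∈ alive Tree.lifetime s (Tree.child false τ),
        x - d - position Tree.lifetime Tree.displacement u s (Tree.child false τ) ∈ S
  · by_cases hg : (alive Tree.lifetime s (Tree.child true τ)).Finite ∧
        ∀ u ∈ alive Tree.lifetime s (Tree.child true τ),
          x - d - position Tree.lifetime Tree.displacement u s (Tree.child true τ) ∈ S
    · rw [if_pos ⟨⟨hf.1, hg.1⟩, hf.2, hg.2⟩, if_pos hf, if_pos hg, Tree.alive_of_le h,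
        ncard_union_eq hdisj (hf.1.image _) (hg.1.image _), ncard_image_of_injective _ (hinj _),
        ncard_image_of_injective _ (hinj _), pow_add]
    · rw [if_neg hg, if_neg fun h => hg ⟨h.1.2, h.2.2⟩, mul_zero]
  · rw [if_neg hf, if_neg fun h => hf ⟨h.1.1, h.2.1⟩, zero_mul]

instance : IsProbabilityMeasure (expMeasure 1) := isProbabilityMeasure_expMeasure one_pos

lemma integral_expMeasure_one (f : ℝ → ℝ) :
    ∫ s, f s ∂(expMeasure 1) = ∫ s in Ioi 0, Real.exp (-s) * f s := by
  have h : expMeasure 1 = volume.withDensity (exponentialPDF 1) := rfl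
  have hm : Measurable (exponentialPDF 1) := (measurable_exponentialPDFReal 1).ennreal_ofReal
  have hlt : ∀ x, exponentialPDF 1 x < ⊤ := fun x => ENNReal.ofReal_lt_top
  rw [h, integral_withDensity_eq_integral_toReal_smul hm (ae_of_all _ hlt), ← integral_Ici_eq_integral_Ioi,
    ← integral_indicator measurableSet_Ici]
  refine integral_congr_ae (ae_of_all _ fun s => ?_)
  by_cases hs : 0 ≤ s
  · simp only [exponentialPDF_eq, if_pos hs, indicator_of_mem (show s ∈ Ici 0 from hs), one_mul,
      smul_eq_mul]
    rw [ENNReal.toReal_ofReal (Real.exp_nonneg _)]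
  · simp [exponentialPDF_eq, hs]

lemma ae_expMeasure_nonneg : ∀ᵐ s ∂(expMeasure 1), 0 ≤ s := by
  have h : expMeasure 1 = volume.withDensity (exponentialPDF 1) := rfl
  have hm : Measurable (exponentialPDF 1) := (measurable_exponentialPDFReal 1).ennreal_ofReal
  rw [h, ae_withDensity_iff hm]
  refine ae_of_all _ fun s hs => ?_
  by_contra hneg
  exact hs (exponentialPDF_of_neg (not_le.1 hneg))

/-- The law of the canonical family of lifetimes and displacement paths. -/
noncomputable def treeLaw (W : Measure (ℝ≥0 → ℝ)) : Measure Tree :=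
  Measure.infinitePi fun _ => (expMeasure 1).prod W

variable (W : Measure (ℝ≥0 → ℝ)) [IsProbabilityMeasure W]

instance : IsProbabilityMeasure (treeLaw W) := by
  unfold treeLaw
  infer_instance

lemma map_child_treeLaw (b : Bool) : (treeLaw W).map (Tree.child b) = treeLaw W :=
  Measure.map_infinitePi_infinitePi_of_inj (f := fun u : List Bool => u ++ [b])
    (List.append_left_injective [b])

/-- Under the canonical law, the initial particle and the subtrees of its two children are
independent, and the subtrees have the same law as the whole tree. -/
lemma map_split_treeLaw :
    (treeLaw W).map (fun τ => (τ [], (Tree.child false τ, Tree.child true τ)))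
      = ((expMeasure 1).prod W).prod ((treeLaw W).prod (treeLaw W)) := by
  have hmc : ∀ b, Measurable (Tree.child b) := Tree.measurable_child
  have h1 : IndepFun (Tree.child false) (Tree.child true) (treeLaw W) := by
    refine indepFun_infinitePi_of_disjoint _ (fun u : List Bool => u ++ [false])
      (fun u : List Bool => u ++ [true]) ?_
    rw [Set.disjoint_left]
    rintro _ ⟨u, rfl⟩ ⟨v, hv⟩
    simp at hv
  have h2 : IndepFun (fun τ : Tree => τ []) (fun τ => (Tree.child false τ, Tree.child true τ))
      (treeLaw W) := by
    have h3 := indepFun_infinitePi_of_disjoint (fun _ : List Bool => (expMeasure 1).prod W)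
      (fun _ : Unit => ([] : List Bool)) (fun p : Bool × List Bool => p.2 ++ [p.1]) (by
        rw [Set.disjoint_left]
        rintro _ ⟨u, rfl⟩ ⟨v, hv⟩
        simp at hv)
    have hφ : Measurable fun f : Unit → ℝ × (ℝ≥0 → ℝ) => f () := measurable_pi_apply ()
    have hψ : Measurable fun f : Bool × List Bool → ℝ × (ℝ≥0 → ℝ) =>
        ((fun u => f (false, u), fun u => f (true, u)) : Tree × Tree) :=
      (measurable_pi_lambda _ fun u => measurable_pi_apply (false, u)).prodMk
        (measurable_pi_lambda _ fun u => measurable_pi_apply (true, u))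
    exact h3.comp hφ hψ
  have hm0 : Measurable fun τ : Tree => τ [] := measurable_pi_apply _
  have h4 := (indepFun_iff_map_prod_eq_prod_map_map hm0.aemeasurable
    ((hmc false).prodMk (hmc true)).aemeasurable).1 h2
  have h5 := (indepFun_iff_map_prod_eq_prod_map_map (hmc false).aemeasurable
    (hmc true).aemeasurable).1 h1
  rw [h4, h5, map_child_treeLaw, map_child_treeLaw]
  congr 1
  exact Measure.infinitePi_map_eval (fun _ : List Bool => (expMeasure 1).prod W) []

lemma ae_lifetime_nonneg : ∀ᵐ τ ∂(treeLaw W), ∀ u, 0 ≤ Tree.lifetime u τ := by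
  rw [ae_all_iff]
  intro u
  have h1 : ∀ᵐ r ∂((expMeasure 1).prod W), 0 ≤ r.1 :=
    Measure.quasiMeasurePreserving_fst.ae ae_expMeasure_nonneg
  have h2 : (treeLaw W).map (fun τ => τ u) = (expMeasure 1).prod W :=
    Measure.infinitePi_map_eval (fun _ : List Bool => (expMeasure 1).prod W) u
  rw [← h2] at h1
  exact ae_of_ae_map (measurable_pi_apply u).aemeasurable h1

/-- The expectation of `branchFunctional` under the canonical law. -/
noncomputable def branchMean (σ : ℝ) (S : Set ℝ) (t x : ℝ) : ℝ :=
  ∫ τ, branchFunctional σ S t x τ ∂(treeLaw W)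

variable {W}

lemma measurable_branchMean (σ : ℝ) {S : Set ℝ} (hS : MeasurableSet S) :
    Measurable (Function.uncurry (branchMean W σ S)) := by
  have h : Measurable fun p : (ℝ × ℝ) × Tree => branchFunctional σ S p.1.1 p.1.2 p.2 :=
    (measurable_branchFunctional σ hS).comp
      (by fun_prop : Measurable fun p : (ℝ × ℝ) × Tree => (p.1.1, p.1.2, p.2))
  exact h.stronglyMeasurable.integral_prod_right'.measurable

lemma abs_branchMean_le {σ : ℝ} (h0 : 0 ≤ σ) (h1 : σ ≤ 1) (S : Set ℝ) (t x : ℝ) :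
    |branchMean W σ S t x| ≤ 1 := by
  have := norm_integral_le_of_norm_le_const (μ := treeLaw W)
    (f := fun τ => branchFunctional σ S t x τ) (C := 1)
    (ae_of_all _ fun τ => abs_branchFunctional_le h0 h1 S t x τ)
  simpa [branchMean] using this

/-- Given the lifetime and path of the root, the two subtrees are independent copies of the tree, so
the expected product is a square. -/
lemma branchMean_eq_integral {σ : ℝ} (h0 : 0 ≤ σ) (h1 : σ ≤ 1) {S : Set ℝ} (hS : MeasurableSet S)
    {t : ℝ} (ht : 0 ≤ t) (x : ℝ) :
    branchMean W σ S t x = ∫ r, (if t < r.1 then S.indicator (fun _ => σ) (x - evalPath r.2 t.toNNReal)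
      else branchMean W σ S (t - r.1) (x - evalPath r.2 r.1.toNNReal) ^ 2) ∂((expMeasure 1).prod W) := by
  set G := branchFunctional σ S with hG
  set H : (ℝ × (ℝ≥0 → ℝ)) × (Tree × Tree) → ℝ := fun p =>
    if t < p.1.1 then S.indicator (fun _ => σ) (x - evalPath p.1.2 t.toNNReal)
    else G (t - p.1.1) (x - evalPath p.1.2 p.1.1.toNNReal) p.2.1
      * G (t - p.1.1) (x - evalPath p.1.2 p.1.1.toNNReal) p.2.2 with hH
  have hHm : Measurable H := by
    refine Measurable.ite (measurableSet_lt measurable_const (by fun_prop)) ?_ (Measurable.mul ?_ ?_)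
    · exact (measurable_const.indicator hS).comp
        (measurable_const.sub (Measurable.evalPath (by fun_prop) measurable_const))
    · exact (measurable_branchFunctional σ hS).comp ((by fun_prop : Measurable
        fun p : (ℝ × (ℝ≥0 → ℝ)) × (Tree × Tree) => t - p.1.1).prodMk
        ((measurable_const.sub (Measurable.evalPath (by fun_prop) (by fun_prop))).prodMk (by fun_prop)))
    · exact (measurable_branchFunctional σ hS).comp ((by fun_prop : Measurable
        fun p : (ℝ × (ℝ≥0 → ℝ)) × (Tree × Tree) => t - p.1.1).prodMk
        ((measurable_const.sub (Measurable.evalPath (by fun_prop) (by fun_prop))).prodMk (by fun_prop)))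
  have hHb : ∀ p, |H p| ≤ 1 := by
    intro p
    simp only [hH]
    split_ifs
    · by_cases h : x - evalPath p.1.2 t.toNNReal ∈ S
      · simpa [h, abs_of_nonneg h0] using h1
      · simp [h]
    · rw [abs_mul]
      exact mul_le_one₀ (abs_branchFunctional_le h0 h1 S _ _ _) (abs_nonneg _)
        (abs_branchFunctional_le h0 h1 S _ _ _)
  have hsplit : Measurable fun τ : Tree => (τ [], (Tree.child false τ, Tree.child true τ)) :=
    (measurable_pi_apply _).prodMk ((Tree.measurable_child _).prodMk (Tree.measurable_child _))
  have e1 : branchMean W σ S t x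
      = ∫ τ, H (τ [], (Tree.child false τ, Tree.child true τ)) ∂(treeLaw W) := by
    refine integral_congr_ae ?_
    filter_upwards [ae_lifetime_nonneg W] with τ hτ
    simp only [hH]
    split_ifs with h
    · exact branchFunctional_of_lt σ S hτ ht h x
    · exact branchFunctional_of_le σ S (not_lt.1 h) x
  rw [e1, ← integral_map (f := H) hsplit.aemeasurable hHm.aestronglyMeasurable, map_split_treeLaw,
    integral_prod _ (Integrable.of_bound hHm.aestronglyMeasurable 1 (ae_of_all _ hHb))]
  refine integral_congr_ae (ae_of_all _ fun r => ?_)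
  simp only [hH]
  split_ifs
  · simp
  · rw [integral_prod_mul, sq]
    rfl

set_option maxHeartbeats 400000 in
-- Integrating out the root: with probability `exp (-t)` it has not split and contributes the heat
-- term; otherwise it splits at a time `s` of density `exp (-s)` at a Gaussian place. Only the
-- one-dimensional marginals of the path enter.
theorem isMildSolution_branchMean (hW : ∀ s, W.map (fun b => evalPath b s) = gaussianReal 0 s)
    {σ : ℝ} (h0 : 0 ≤ σ) (h1 : σ ≤ 1) {S : Set ℝ} (hS : MeasurableSet S) :
    IsMildSolution (S.indicator fun _ => σ) (branchMean W σ S) where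
  measurable := measurable_branchMean σ hS
  bound := abs_branchMean_le h0 h1 S
  measurable_initial := measurable_const.indicator hS
  bound_initial x := by
    by_cases h : x ∈ S
    · simpa [h, abs_of_nonneg h0] using h1
    · simp [h]
  equation t ht x := by
    have hmU := measurable_branchMean (W := W) σ hS
    have hbU := abs_branchMean_le (W := W) h0 h1 S
    have hbq : ∀ s y, |branchMean W σ S s y ^ 2| ≤ 1 := fun s y => by
      rw [abs_pow]
      exact pow_le_one₀ (abs_nonneg _) (hbU s y)
    have hmq : Measurable (Function.uncurry fun s y => branchMean W σ S s y ^ 2) := hmU.pow_const 2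
    have hme : ∀ s, Measurable fun b : ℝ≥0 → ℝ => evalPath b s := fun s =>
      measurable_id.evalPath measurable_const
    have hind : Measurable (S.indicator fun _ => σ) := measurable_const.indicator hS
    have hbind : ∀ y, |S.indicator (fun _ => σ) y| ≤ 1 := fun y => by
      by_cases h : y ∈ S
      · simpa [h, abs_of_nonneg h0] using h1
      · simp [h]
    have hheat : ∀ (s : ℝ) (f : ℝ → ℝ), Measurable f →
        ∫ b, f (x - evalPath b s.toNNReal) ∂W = heatOp s f x := by
      intro s f hf
      rw [heatOp, ← hW, integral_map (hme _).aemeasurable]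
      exact Measurable.aestronglyMeasurable (by fun_prop)
    have hKm : Measurable fun r : ℝ × (ℝ≥0 → ℝ) =>
        if t < r.1 then S.indicator (fun _ => σ) (x - evalPath r.2 t.toNNReal)
        else branchMean W σ S (t - r.1) (x - evalPath r.2 r.1.toNNReal) ^ 2 := by
      have m1 : Measurable fun r : ℝ × (ℝ≥0 → ℝ) => x - evalPath r.2 t.toNNReal :=
        measurable_const.sub (measurable_snd.evalPath measurable_const)
      have m2 : Measurable fun r : ℝ × (ℝ≥0 → ℝ) => (t - r.1, x - evalPath r.2 r.1.toNNReal) :=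
        (measurable_const.sub measurable_fst).prodMk
          (measurable_const.sub (measurable_snd.evalPath measurable_fst.real_toNNReal))
      have m3 := hind.comp m1
      have m4 := hmq.comp m2
      exact Measurable.ite (measurableSet_lt measurable_const measurable_fst) m3 m4
    rw [branchMean_eq_integral h0 h1 hS ht, integral_prod _ (Integrable.of_bound
      hKm.aestronglyMeasurable 1 (ae_of_all _ fun r => by
        rw [Real.norm_eq_abs]
        split_ifs
        · exact hbind _
        · exact hbq _ _)), integral_expMeasure_one]
    have e1 : ∀ s, ∫ b, (if t < (s, b).1 then S.indicator (fun _ => σ) (x - evalPath b t.toNNReal)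
        else branchMean W σ S (t - s) (x - evalPath b s.toNNReal) ^ 2) ∂W
        = if t < s then heatOp t (S.indicator fun _ => σ) x
          else heatOp s (fun y => branchMean W σ S (t - s) y ^ 2) x := by
      intro s
      split_ifs
      · exact hheat t _ hind
      · exact hheat s (fun y => branchMean W σ S (t - s) y ^ 2) (hmq.comp measurable_prodMk_left)
    simp_rw [e1]
    have hm2 : Measurable fun s => heatOp s (fun y => branchMean W σ S (t - s) y ^ 2) x :=
      measurable_heatOp (f := fun s y => branchMean W σ S (t - s) y ^ 2) measurable_id
        measurable_const (hmq.comp (by fun_prop : Measurable fun p : ℝ × ℝ => (t - p.1, p.2)))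
    have hint : IntegrableOn (fun s => Real.exp (-s) * (if t < s then heatOp t (S.indicator fun _ => σ) x
          else heatOp s (fun y => branchMean W σ S (t - s) y ^ 2) x)) (Ioi 0) := by
      refine integrable_mul_of_bounded (C := 1) (integrableOn_exp_neg_Ioi 0)
        (Measurable.ite (measurableSet_lt measurable_const measurable_id) measurable_const hm2)
        fun s => ?_
      split_ifs
      · exact abs_heatOp_le hbind
      · exact abs_heatOp_le (hbq _)
    rw [← Ioc_union_Ioi_eq_Ioi ht, setIntegral_union (Ioc_disjoint_Ioi le_rfl) measurableSet_Ioi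
      (hint.mono_set Ioc_subset_Ioi_self) (hint.mono_set (Ioi_subset_Ioi ht)), add_comm]
    congr 1
    · rw [setIntegral_congr_fun (g := fun s => Real.exp (-s) * heatOp t (S.indicator fun _ => σ) x)
        measurableSet_Ioi fun s (hs : t < s) => by simp only [if_pos hs],
        integral_mul_const, integral_exp_neg_Ioi]
    · rw [setIntegral_congr_fun (g := fun s => Real.exp (-s) *
          heatOp s (fun y => branchMean W σ S (t - s) y ^ 2) x)
        measurableSet_Ioc fun s hs => by simp only [if_neg (not_lt.2 hs.2)],
        ← intervalIntegral.integral_of_le ht]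
      -- The substitution `s ↦ t - s` passes from the time of the first split to the time remaining
      -- after it.
      have := intervalIntegral.integral_comp_sub_left (a := 0) (b := t)
        (fun s => Real.exp (-s) * heatOp s (fun y => branchMean W σ S (t - s) y ^ 2) x) t
      simpa using this.symm

/-! ### Particle numbers, and transfer to the given branching Brownian motion -/

section Canonical

variable {W : Measure (ℝ≥0 → ℝ)} [IsProbabilityMeasure W]

lemma branchMean_univ (hW : ∀ s, W.map (fun b => evalPath b s) = gaussianReal 0 s)
    {σ : ℝ} (h0 : 0 ≤ σ) (h1 : σ ≤ 1) {t : ℝ} (ht : 0 ≤ t) (x : ℝ) :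
    branchMean W σ univ t x = reactionRate σ t := by
  have h := isMildSolution_branchMean hW h0 h1 MeasurableSet.univ
  rw [indicator_univ] at h
  -- Without a constraint on positions the functional does not depend on `x`.
  exact h.eq_reactionRate h0 h1 (fun t x y => integral_congr_ae (ae_of_all _ fun τ => by
    classical exact if_congr (by simp) rfl rfl)) ht x

lemma integrable_branchFunctional {σ : ℝ} (h0 : 0 ≤ σ) (h1 : σ ≤ 1) {S : Set ℝ}
    (hS : MeasurableSet S) (t x : ℝ) : Integrable (branchFunctional σ S t x) (treeLaw W) :=
  Integrable.of_bound ((measurable_branchFunctional σ hS).comp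
    (by fun_prop : Measurable fun τ : Tree => (t, x, τ))).aestronglyMeasurable 1
    (ae_of_all _ fun τ => abs_branchFunctional_le h0 h1 S t x τ)

/-- Almost surely there are finitely many particles. -/
lemma ae_finite_alive (hW : ∀ s, W.map (fun b => evalPath b s) = gaussianReal 0 s) {t : ℝ}
    (ht : 0 ≤ t) : ∀ᵐ τ ∂(treeLaw W), (alive Tree.lifetime t τ).Finite := by
  -- For `σ = 1` the functional is the indicator of finiteness, and its mean `reactionRate 1 t`
  -- equals `1`: there is no explosion.
  have hm := branchMean_univ hW zero_le_one le_rfl ht 0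
  have hi := integrable_branchFunctional (W := W) zero_le_one le_rfl MeasurableSet.univ t 0
  have h0 : ∫ τ, (1 - branchFunctional 1 univ t 0 τ) ∂(treeLaw W) = 0 := by
    rw [integral_sub (integrable_const _) hi, ← branchMean, hm]
    simp [reactionRate]
  have h1 := (integral_eq_zero_iff_of_nonneg (fun τ => sub_nonneg.2
    ((le_abs_self _).trans (abs_branchFunctional_le zero_le_one le_rfl univ t 0 τ)))
    ((integrable_const _).sub hi)).1 h0
  filter_upwards [h1] with τ hτ
  by_contra hfin
  simp [branchFunctional, hfin] at hτ

/-- Almost surely there is a particle. -/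
lemma ae_nonempty_alive (hW : ∀ s, W.map (fun b => evalPath b s) = gaussianReal 0 s) {t : ℝ}
    (ht : 0 ≤ t) : ∀ᵐ τ ∂(treeLaw W), (alive Tree.lifetime t τ).Nonempty := by
  -- For `σ = 0` the functional is the indicator that no particle is alive, as `0 ^ 0 = 1`, and its
  -- mean `reactionRate 0 t` is `0`.
  have hm := branchMean_univ hW le_rfl zero_le_one ht 0
  have hi := integrable_branchFunctional (W := W) le_rfl zero_le_one MeasurableSet.univ t 0
  have hnn : ∀ τ, 0 ≤ branchFunctional 0 univ t 0 τ := fun τ => by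
    unfold branchFunctional
    split_ifs
    · exact pow_nonneg le_rfl _
    · exact le_rfl
  have h0 : ∫ τ, branchFunctional 0 univ t 0 τ ∂(treeLaw W) = 0 := by
    rw [← branchMean, hm]
    simp [reactionRate]
  filter_upwards [(integral_eq_zero_iff_of_nonneg hnn hi).1 h0] with τ hτ
  by_contra hne
  simp [branchFunctional, not_nonempty_iff_eq_empty.1 hne] at hτ

end Canonical

variable {Ω : Type*}

/-- The lifetimes and displacement paths as an element of the canonical space. -/
def toTree (e : List Bool → Ω → ℝ) (B : List Bool → ℝ≥0 → Ω → ℝ) (ω : Ω) : Tree :=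
  fun u => (e u ω, fun s => B u s ω)

variable {e : List Bool → Ω → ℝ} {B : List Bool → ℝ≥0 → Ω → ℝ}

lemma birthTime_toTree (ω : Ω) : ∀ u,
    birthTime Tree.lifetime u (toTree e B ω) = birthTime e u ω
  | [] => rfl
  | _ :: u => by
    rw [birthTime, birthTime, birthTime_toTree ω u]
    rfl

lemma alive_toTree (t : ℝ) (ω : Ω) : alive Tree.lifetime t (toTree e B ω) = alive e t ω := by
  ext u
  simp only [alive, birthTime_toTree]
  rfl

lemma displacement_toTree {ω : Ω} (hω : ∀ u, Continuous fun s => B u s ω) (u : List Bool)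
    (s : ℝ≥0) : Tree.displacement u s (toTree e B ω) = B u s ω :=
  evalPath_of_continuous (hω u) s

lemma birthPlace_toTree {ω : Ω} (hω : ∀ u, Continuous fun s => B u s ω) : ∀ u,
    birthPlace Tree.lifetime Tree.displacement u (toTree e B ω) = birthPlace e B u ω
  | [] => rfl
  | _ :: u => by
    rw [birthPlace, birthPlace, birthPlace_toTree hω u, displacement_toTree hω]
    rfl

lemma position_toTree {ω : Ω} (hω : ∀ u, Continuous fun s => B u s ω) (u : List Bool) (t : ℝ) :
    position Tree.lifetime Tree.displacement u t (toTree e B ω) = position e B u t ω := by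
  rw [position, position, birthPlace_toTree hω, birthTime_toTree, displacement_toTree hω]

variable [MeasurableSpace Ω] {P : Measure Ω}

/-- The law of the displacement path of the initial particle. -/
noncomputable def pathLaw (P : Measure Ω) (B : List Bool → ℝ≥0 → Ω → ℝ) : Measure (ℝ≥0 → ℝ) :=
  P.map fun ω s => B [] s ω

namespace IsBBM

lemma measurable_path (h : IsBBM e B P) (u : List Bool) : Measurable fun ω (s : ℝ≥0) => B u s ω :=
  measurable_pi_lambda _ fun s => h.measurable_displacement u s

lemma ae_continuous (h : IsBBM e B P) : ∀ᵐ ω ∂P, ∀ u, Continuous fun s => B u s ω :=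
  ae_all_iff.2 fun u => (h.brownian u).cont

/-- Finite-dimensional distributions determine a law on the product space, so the path laws of all
particles coincide. -/
lemma map_path (h : IsBBM e B P) (u : List Bool) :
    P.map (fun ω (s : ℝ≥0) => B u s ω) = pathLaw P B := by
  have hlim : ∀ u, IsProjectiveLimit (P.map fun ω (s : ℝ≥0) => B u s ω)
      BrownianReal.projectiveFamily := by
    intro u I
    rw [Measure.map_map (by fun_prop) (h.measurable_path u)]
    exact ((h.brownian u).hasLaw I).map_eq
  have : ∀ I, IsFiniteMeasure (BrownianReal.projectiveFamily I) := fun I => inferInstance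
  exact (hlim u).unique (hlim [])

lemma measurable_toTree (h : IsBBM e B P) : Measurable (toTree e B) :=
  measurable_pi_lambda _ fun u => (h.measurable_lifetime u).prodMk (h.measurable_path u)

lemma pathLaw_map_evalPath (h : IsBBM e B P) (s : ℝ≥0) :
    (pathLaw P B).map (fun b => evalPath b s) = gaussianReal 0 s := by
  have hm : Measurable fun b : ℝ≥0 → ℝ => evalPath b s := measurable_id.evalPath measurable_const
  rw [pathLaw, Measure.map_map hm (h.measurable_path []), ← ((h.brownian []).hasLaw_eval s).map_eq]
  refine Measure.map_congr ?_
  filter_upwards [(h.brownian []).cont] with ω hω using evalPath_of_continuous hω s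

variable [IsProbabilityMeasure P]

lemma isProbabilityMeasure_pathLaw (h : IsBBM e B P) : IsProbabilityMeasure (pathLaw P B) :=
  Measure.isProbabilityMeasure_map (h.measurable_path []).aemeasurable

lemma map_toTree (h : IsBBM e B P) : P.map (toTree e B) = treeLaw (pathLaw P B) := by
  have hm : ∀ u, Measurable fun ω => (e u ω, fun s : ℝ≥0 => B u s ω) := fun u =>
    (h.measurable_lifetime u).prodMk (h.measurable_path u)
  have h1 := h.indep_particles.map_fun_eq_infinitePi_map hm
  have h2 : ∀ u, P.map (fun ω => (e u ω, fun s : ℝ≥0 => B u s ω))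
      = (expMeasure 1).prod (pathLaw P B) := by
    intro u
    rw [(indepFun_iff_map_prod_eq_prod_map_map (h.measurable_lifetime u).aemeasurable
      (h.measurable_path u).aemeasurable).1 (h.indep_lifetime_displacement u),
      (h.lifetime_law u).map_eq, h.map_path]
  simp_rw [h2] at h1
  exact h1

lemma ae_alive (h : IsBBM e B P) {t : ℝ} (ht : 0 ≤ t) :
    ∀ᵐ ω ∂P, (alive e t ω).Finite ∧ (alive e t ω).Nonempty := by
  have := h.isProbabilityMeasure_pathLaw
  have h1 := (ae_finite_alive h.pathLaw_map_evalPath ht).and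
    (ae_nonempty_alive h.pathLaw_map_evalPath ht)
  rw [← h.map_toTree] at h1
  filter_upwards [ae_of_ae_map h.measurable_toTree.aemeasurable h1] with ω hω
  simpa only [alive_toTree] using hω

lemma integral_branchFunctional (h : IsBBM e B P) (σ : ℝ) {S : Set ℝ} (hS : MeasurableSet S)
    (t x : ℝ) :
    ∫ ω, branchFunctional σ S t x (toTree e B ω) ∂P = branchMean (pathLaw P B) σ S t x := by
  have hm : Measurable (branchFunctional σ S t x) := (measurable_branchFunctional σ hS).comp
    (by fun_prop : Measurable fun τ : Tree => (t, x, τ))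
  rw [branchMean, ← h.map_toTree, integral_map h.measurable_toTree.aemeasurable
    hm.aestronglyMeasurable]

/-- The extra factor `σ` turns `σ ^ (n - 1)` into `σ ^ n`; with truncated subtraction this requires
`n ≥ 1`, which holds almost surely. -/
lemma mul_partitionFunction (h : IsBBM e B P) {σ : ℝ} (h0 : 0 ≤ σ) (h1 : σ ≤ 1) {t : ℝ}
    (ht : 0 ≤ t) : σ * partitionFunction P e σ t = reactionRate σ t := by
  have := h.isProbabilityMeasure_pathLaw
  rw [← branchMean_univ h.pathLaw_map_evalPath h0 h1 ht 0,
    ← h.integral_branchFunctional σ MeasurableSet.univ, partitionFunction, ← integral_const_mul]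
  refine integral_congr_ae ?_
  filter_upwards [h.ae_alive ht] with ω hω
  have hn : (alive e t ω).ncard ≠ 0 := (ncard_pos hω.1).2 hω.2 |>.ne'
  simp only [particleNumber, branchFunctional, alive_toTree, hω.1, mem_univ, implies_true, and_self,
    if_true]
  exact mul_pow_sub_one hn σ

lemma mul_integral_indicator (h : IsBBM e B P) (σ : ℝ) {t : ℝ} (ht : 0 ≤ t) (x : ℝ) :
    σ * ∫ ω, {ω | ∀ u ∈ alive e t ω, position e B u t ω ≤ x}.indicator
      (fun ω => σ ^ (particleNumber e t ω - 1)) ω ∂P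
      = branchMean (pathLaw P B) σ (Ici 0) t x := by
  rw [← h.integral_branchFunctional σ measurableSet_Ici, ← integral_const_mul]
  refine integral_congr_ae ?_
  filter_upwards [h.ae_alive ht, h.ae_continuous] with ω hω hc
  have hn : (alive e t ω).ncard ≠ 0 := (ncard_pos hω.1).2 hω.2 |>.ne'
  have key : ((alive Tree.lifetime t (toTree e B ω)).Finite ∧ ∀ u ∈ alive Tree.lifetime t (toTree e B ω),
      x - position Tree.lifetime Tree.displacement u t (toTree e B ω) ∈ Ici 0)
      ↔ ∀ u ∈ alive e t ω, position e B u t ω ≤ x := by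
    simp only [alive_toTree, hω.1, position_toTree hc, true_and, mem_Ici, sub_nonneg]
  by_cases hA : ∀ u ∈ alive e t ω, position e B u t ω ≤ x
  · have hA' : ω ∈ {ω | ∀ u ∈ alive e t ω, position e B u t ω ≤ x} := hA
    rw [branchFunctional, if_pos (key.2 hA), indicator_of_mem hA', alive_toTree]
    exact mul_pow_sub_one hn σ
  · have hA' : ω ∉ {ω | ∀ u ∈ alive e t ω, position e B u t ω ≤ x} := hA
    rw [branchFunctional, if_neg (mt key.1 hA), indicator_of_notMem hA', mul_zero]

lemma frontTail_eq (h : IsBBM e B P) {σ : ℝ} (h0 : 0 < σ) (h1 : σ ≤ 1) {t : ℝ} (ht : 0 ≤ t)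
    (x : ℝ) : frontTail P e B σ t x
      = 1 - branchMean (pathLaw P B) σ (Ici 0) t x / reactionRate σ t := by
  rw [frontTail, tiltedProb, ← h.mul_integral_indicator σ ht x, ← h.mul_partitionFunction h0.le h1 ht,
    mul_div_mul_left _ _ h0.ne']

end IsBBM

/-! ### From the mild equation to F-KPP, and the theorem -/

/-- Quotients of mild solutions by the spatially constant solution solve the F-KPP equation. -/
theorem IsMildSolution.isFKPPSolution {σ : ℝ} (h0 : 0 < σ) (h1 : σ ≤ 1) {u w : ℝ → ℝ → ℝ}
    (hu : IsMildSolution ((Ici 0).indicator fun _ => σ) u)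
    (hw : ∀ t, 0 ≤ t → ∀ x, w t x = 1 - u t x / reactionRate σ t) :
    IsFKPPSolution (reactionRate σ) heavisideDatum w := by
  have hV := reactionRate_pos h0 h1
  have hVd := hasDerivAt_reactionRate h0.le h1
  have hVc : Continuous (reactionRate σ) := continuous_iff_continuousAt.2 fun t => (hVd t).continuousAt
  have hwt : ∀ t, 0 ≤ t → w t = fun x => 1 - u t x / reactionRate σ t := fun t ht =>
    funext (hw t ht)
  have hud : ∀ t, 0 < t → ∀ x, HasDerivAt (u t) (deriv (u t) x) x := fun t ht x =>
    ((hu.contDiff_space ht).differentiable two_ne_zero x).hasDerivAt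
  have hudd : ∀ t, 0 < t → ∀ x, HasDerivAt (deriv (u t)) (deriv (deriv (u t)) x) x := fun t ht x =>
    ((hu.contDiff_space ht).differentiable_deriv_two x).hasDerivAt
  have hdw : ∀ t, 0 < t → deriv (w t) = fun x => -(deriv (u t) x / reactionRate σ t) := by
    intro t ht
    rw [hwt t ht.le]
    exact funext fun x => (((hud t ht x).div_const _).const_sub 1).deriv
  have hddw : ∀ t, 0 < t → ∀ x,
      iteratedDeriv 2 (w t) x = -(deriv (deriv (u t)) x / reactionRate σ t) := by
    intro t ht x
    rw [iteratedDeriv_succ, iteratedDeriv_one, hdw t ht]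
    exact (((hudd t ht x).div_const _).fun_neg).deriv
  have htime : ∀ t, 0 < t → ∀ x, HasDerivAt (fun s => w s x)
      (-(((1 / 2 * deriv (deriv (u t)) x + u t x ^ 2 - u t x) * reactionRate σ t
        - u t x * (reactionRate σ t ^ 2 - reactionRate σ t)) / reactionRate σ t ^ 2)) t := by
    intro t ht x
    refine (((hu.hasDerivAt_time ht x).fun_div (hVd t) (hV t).ne').const_sub 1).congr_of_eventuallyEq ?_
    filter_upwards [lt_mem_nhds ht] with s hs using hw s hs.le x
  have hVcp : ∀ p : ℝ × ℝ, ContinuousAt (fun p : ℝ × ℝ => reactionRate σ p.1) p := fun p =>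
    (hVc.comp continuous_fst).continuousAt
  refine ⟨fun T => ⟨1 + 1 / reactionRate σ T, fun t ht htT x => ?_⟩, fun x => ?_, fun x hx => ?_,
    fun t ht x => (htime t ht x).differentiableAt, fun t ht => ?_, ?_, ?_, ?_, fun t ht x => ?_⟩
  -- The reaction rate decreases in time, so its value at `T` bounds the denominator from below on
  -- `[0, T]`.
  · rw [hw t ht]
    refine (abs_sub _ _).trans (add_le_add (by simp) ?_)
    rw [abs_div, abs_of_pos (hV t)]
    refine div_le_div₀ zero_le_one (hu.bound t x) (hV T) ?_
    refine div_le_div_of_nonneg_left h0.le (reactionRate_den_pos h0.le h1 t) ?_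
    have := mul_le_mul_of_nonneg_left (Real.exp_le_exp.2 htT) (sub_nonneg.2 h1)
    linarith
  · have hu0 : u 0 x = (Ici 0).indicator (fun _ => σ) x := by
      simp [hu.equation 0 le_rfl x, heatOp_zero]
    rw [hw 0 le_rfl, hu0, heavisideDatum]
    by_cases hx : x < 0
    · simp [hx]
    · simp [not_lt.1 hx, reactionRate, h0.ne']
  · have hf : ContinuousAt ((Ici 0).indicator fun _ => σ) x := by
      have : ((Ici (0 : ℝ)).indicator fun _ => σ) = fun x => σ * (1 - heavisideDatum x) := by
        ext y
        by_cases hy : y < 0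
        · simp [heavisideDatum, hy]
        · simp [heavisideDatum, hy, not_lt.1 hy]
      rw [this]
      exact (hx.const_sub 1).const_mul σ
    have hc : ContinuousWithinAt (fun p : ℝ × ℝ => 1 - u p.1 p.2 / reactionRate σ p.1)
        {p | 0 ≤ p.1} (0, x) :=
      continuousWithinAt_const.sub ((hu.continuousWithinAt_initial hf).div
        (hVcp (0, x)).continuousWithinAt (hV 0).ne')
    exact hc.congr (fun p hp => hw p.1 hp p.2) (hw 0 le_rfl x)
  · rw [hwt t ht.le]
    exact contDiff_const.sub ((hu.contDiff_space ht).div_const _)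
  · rintro ⟨t, x⟩ (ht : 0 < t)
    have hc1 := hu.continuousAt_uncurry ht x
    have hc2 := hu.continuousAt_deriv_space_two ht x
    have hc3 := hVcp (t, x)
    have : ContinuousAt (fun p : ℝ × ℝ => -(((1 / 2 * deriv (deriv (u p.1)) p.2 + u p.1 p.2 ^ 2
        - u p.1 p.2) * reactionRate σ p.1 - u p.1 p.2 * (reactionRate σ p.1 ^ 2
        - reactionRate σ p.1)) / reactionRate σ p.1 ^ 2)) (t, x) :=
      (((((hc2.const_mul _).add (hc1.pow 2)).sub hc1).mul hc3).sub
        (hc1.mul ((hc3.pow 2).sub hc3))).div (hc3.pow 2) (pow_pos (hV t) 2).ne' |>.neg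
    exact this.continuousWithinAt.congr (fun p hp => (htime p.1 hp p.2).deriv) (htime t ht x).deriv
  · rintro ⟨t, x⟩ (ht : 0 < t)
    have hc := (hu.continuousAt_deriv_space ht x).div (hVcp (t, x))
      (hV t).ne' |>.neg
    exact hc.continuousWithinAt.congr (fun p hp => congrFun (hdw p.1 hp) p.2)
      (congrFun (hdw t ht) x)
  · rintro ⟨t, x⟩ (ht : 0 < t)
    have hc := (hu.continuousAt_deriv_space_two ht x).div (hVcp (t, x))
      (hV t).ne' |>.neg
    exact hc.continuousWithinAt.congr (fun p hp => hddw p.1 hp p.2) (hddw t ht x)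
  -- Write `v` for the rate. With `v' = v² - v` the linear terms cancel and the reaction is `-u² / v
  -- + u = u (1 - u / v)`, which is `v (1 - w) w` because `u = v (1 - w)`.
  · rw [(htime t ht x).deriv, hddw t ht, hw t ht.le]
    have := (hV t).ne'
    field_simp
    ring

end BBM

lemma continuousAt_heavisideDatum {x : ℝ} (hx : x ≠ 0) : ContinuousAt heavisideDatum x := by
  rcases hx.lt_or_gt with h | h
  · refine (continuousAt_const (y := (1 : ℝ))).congr ?_
    filter_upwards [gt_mem_nhds h] with y hy
    simp [heavisideDatum, hy]
  · refine (continuousAt_const (y := (0 : ℝ))).congr ?_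
    filter_upwards [lt_mem_nhds h] with y hy
    simp [heavisideDatum, not_lt.2 hy.le]

theorem mainTheorem7 {Ω : Type*} [MeasurableSpace Ω] (P : Measure Ω) [IsProbabilityMeasure P]
    (e : List Bool → Ω → ℝ) (B : List Bool → ℝ≥0 → Ω → ℝ) (hBBM : BBM.IsBBM e B P)
    (σ : ℝ) (hσ0 : 0 < σ) (hσ1 : σ ≤ 1) :
    IsFKPPSolution (reactionRate σ) heavisideDatum (BBM.frontTail P e B σ) ∧
      ∀ w : ℝ → ℝ → ℝ, IsFKPPSolution (reactionRate σ) heavisideDatum w →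
        ∀ t : ℝ, 0 ≤ t → ∀ x : ℝ, w t x = BBM.frontTail P e B σ t x := by
  have := hBBM.isProbabilityMeasure_pathLaw
  have hsol : IsFKPPSolution (reactionRate σ) heavisideDatum (BBM.frontTail P e B σ) :=
    (BBM.isMildSolution_branchMean hBBM.pathLaw_map_evalPath hσ0.le hσ1
      measurableSet_Ici).isFKPPSolution hσ0 hσ1 fun t ht x => hBBM.frontTail_eq hσ0 hσ1 ht x
  refine ⟨hsol, fun w hw t ht x => ?_⟩
  have hg : ∀ t, 0 ≤ t → |reactionRate σ t| ≤ 1 := fun t _ => by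
    rw [abs_of_nonneg (reactionRate_nonneg hσ0.le hσ1 t)]
    exact reactionRate_le_one hσ0.le hσ1 t
  rcases ht.eq_or_lt with rfl | ht
  · rw [hw.initial, hsol.initial]
  · exact le_antisymm (hw.le hsol (fun x => continuousAt_heavisideDatum) hg ht x)
      (hsol.le hw (fun x => continuousAt_heavisideDatum) hg ht x)
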